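/- **Setting.** Work with algebraic vector bundles over $\mathbb C$. Let $n\ge 0$, let $V_1=V_2=\mathbb C^{n+1}$, let $\mathbb P(V_i)$ be the projective space of lines in $V_i$, and let $\eta_i:V_i\setminus\{0\}\to\mathbb P(V_i)$ be the projection. Let $g_0,\dots,g_n$ be homogeneous polynomials on $V_1$ of degrees $d_0,\dots,d_n$, without common zero in $V_1\setminus\{0\}$, and let $\omega=(g_0,\dots,g_n):V_1\setminus\{0\}\to V_2\setminus\{0\}$. Let $\mathbb C^*$ act on $V_1$ by scalar multiplication, on $V_2$ by $\sigma(t)=\mathrm{diag}(t^{d_0},\dots,t^{d_n})$, and on $\mathbb P(V_2)$ by the action $\overline\sigma$ induced by $\sigma$; then $\omega$ and $\eta_2$ are equivariant. A $\mathbb C^*$-bundle is a vector bundle with an algebraic, fibrewise linear $\mathbb C^*$-action above the given action on the base. Pull back $\eta_1^*$ is an equivalence from the category of vector bundles on $\mathbb P(V_1)$ to the category of $\mathbb C^*$-bundles on $V_1\setminus\{0\}$. The generalized inverse image (Horrocks) functor $\mathbf{Iminvg}$, from $\mathbb C^*$-bundles on $\mathbb P(V_2)$ above $\overline\sigma$ to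 vector bundles on $\mathbb P(V_1)$, is the functor, unique up to isomorphism, such that $\eta_1^*\,\mathbf{Iminvg}(F)\simeq\omega^*\eta_2^*F$ as $\mathbb C^*$-bundles, naturally in $F$. For an integer $q$ and a $\mathbb C^*$-bundle $E$ on $\mathbb P(V_2)$ above $\overline\sigma$, let $E^{(q)}$ be the same vector bundle with the action multiplied by the character $t^q$. For an integer $k$, the bundle $\mathcal O_{\mathbb P(V_2)}(k)$, whose fibre at a line $x$ is $x^{-k}$, carries the natural action induced by $\sigma$, and $\mathcal O^{(q)}_{\mathbb P(V_2)}(k)$ denotes $\mathcal O_{\mathbb P(V_2)}(k)$ with this action multiplied by $t^q$. **Proposition 2.3.** For every integer $q$: 1. $\mathbf{Iminvg}\big(\mathcal O^{(q)}_{\mathbb P(V_2)}(k)\big)\simeq\mathcal O_{\mathbb P(V_1)}(q)$ for every integer $k$; 2. $\mathbf{Iminvg}(E^{(q)})\simeq\mathbf{Iminvg}(E)\otimes\mathcal O_{\mathbb P(V_1)}(q)$ for every $\mathbb C^*$-bundle $E$ on $\mathbb P(V_2)$ above $\overline\sigma$, naturally in $E$. -/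

import Mathlib

open Filter Topology CategoryTheory
open scoped LinearAlgebra.Projectivization TensorProduct

namespace Horrocks

noncomputable section

/-- A space with a sheaf of complex valued functions, in the sense of Serre: a topological space
(for us with its Zariski topology) together with the datum of which functions are regular near
which point. Only the germ of `f` at `x` matters for `RegularAt f x`, so that total functions
may take arbitrary values away from `x`. -/
class FunctionSpace (X : Type) extends TopologicalSpace X where
  RegularAt : (X → ℂ) → X → Prop
  regularAt_const : ∀ (c : ℂ) x, RegularAt (fun _ => c) x
  regularAt_add : ∀ {f g x}, RegularAt f x → RegularAt g x → RegularAt (fun y => f y + g y) x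
  regularAt_mul : ∀ {f g x}, RegularAt f x → RegularAt g x → RegularAt (fun y => f y * g y) x
  regularAt_inv : ∀ {f x}, RegularAt f x → f x ≠ 0 → RegularAt (fun y => (f y)⁻¹) x
  regularAt_congr : ∀ {f g x}, RegularAt f x → (∀ᶠ y in 𝓝 x, g y = f y) → RegularAt g x
  regularAt_eventually : ∀ {f x}, RegularAt f x → ∀ᶠ y in 𝓝 x, RegularAt f y
  eventually_ne_zero : ∀ {f x}, RegularAt f x → f x ≠ 0 → ∀ᶠ y in 𝓝 x, f y ≠ 0

open FunctionSpace

/-- Local data generating a space with functions: near `z` the open sets are the sets of the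
`base z` cut out by `q ≠ 0`, and the regular functions are the quotients `p / q`, where `p` and `q`
run through the algebra generated by `gen z`. -/
structure LocalGenerators (Z : Type) where
  base : Z → Filter Z
  gen : Z → Set (Z → ℂ)
  pure_le : ∀ z, pure z ≤ base z
  base_eventually : ∀ z, ∀ s ∈ base z, ∀ᶠ w in base z, s ∈ base w
  gen_eventually : ∀ z, ∀ f ∈ gen z, ∀ᶠ w in base z, f ∈ gen w

namespace LocalGenerators

variable {Z : Type} (G : LocalGenerators Z)

def alg (z : Z) : Subalgebra ℂ (Z → ℂ) := Algebra.adjoin ℂ (G.gen z)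

lemma alg_eventually {z : Z} {f : Z → ℂ} (hf : f ∈ G.alg z) : ∀ᶠ w in G.base z, f ∈ G.alg w := by
  induction hf using Algebra.adjoin_induction with
  | mem f hf => exact (G.gen_eventually z f hf).mono fun w hw => Algebra.subset_adjoin hw
  | algebraMap r => exact .of_forall fun w => Subalgebra.algebraMap_mem _ r
  | add f g _ _ hf hg => filter_upwards [hf, hg] with w h1 h2 using add_mem h1 h2
  | mul f g _ _ hf hg => filter_upwards [hf, hg] with w h1 h2 using mul_mem h1 h2

/-- The neighbourhoods of `z`. -/
def nbhd (z : Z) : Filter Z where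
  sets := {s | ∃ q ∈ G.alg z, q z ≠ 0 ∧ ∀ᶠ w in G.base z, q w ≠ 0 → w ∈ s}
  univ_sets := ⟨1, one_mem _, by simp, by simp⟩
  sets_of_superset := by
    rintro s t ⟨q, hq, h0, h⟩ hst
    exact ⟨q, hq, h0, h.mono fun w hw h => hst (hw h)⟩
  inter_sets := by
    rintro s t ⟨q, hq, h0, h⟩ ⟨r, hr, h0', h'⟩
    refine ⟨q * r, mul_mem hq hr, mul_ne_zero h0 h0', ?_⟩
    filter_upwards [h, h'] with w h h' hw
    exact ⟨h (left_ne_zero_of_mul hw), h' (right_ne_zero_of_mul hw)⟩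

lemma mem_nbhd {z : Z} {s : Set Z} : s ∈ G.nbhd z ↔
    ∃ q ∈ G.alg z, q z ≠ 0 ∧ ∀ᶠ w in G.base z, q w ≠ 0 → w ∈ s := Iff.rfl

/-- The regular functions near `z`: locally quotients of functions in the given algebra. -/
def Regular (f : Z → ℂ) (z : Z) : Prop :=
  ∃ p ∈ G.alg z, ∃ q ∈ G.alg z, q z ≠ 0 ∧ ∀ᶠ w in G.base z, q w ≠ 0 → f w = p w / q w

lemma pure_le_nbhd : pure ≤ G.nbhd := by
  rintro z s ⟨q, -, h0, h⟩
  exact (G.pure_le z h : _) h0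

lemma spread {z : Z} {q : Z → ℂ} (hq : q ∈ G.alg z) (h0 : q z ≠ 0) {P : Z → Prop}
    (h : ∀ᶠ w in G.base z, P w) : ∀ᶠ w in G.nbhd z, q ∈ G.alg w ∧ q w ≠ 0 ∧
      ∀ᶠ w' in G.base w, P w' := by
  refine ⟨q, hq, h0, ?_⟩
  filter_upwards [G.alg_eventually hq, G.base_eventually z _ h] with w h1 h2 h3
  exact ⟨h1, h3, h2⟩

abbrev topology : TopologicalSpace Z := TopologicalSpace.mkOfNhds G.nbhd

lemma nhds_eq (z : Z) : @nhds Z G.topology z = G.nbhd z := by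
  refine TopologicalSpace.nhds_mkOfNhds _ _ G.pure_le_nbhd ?_
  rintro z s ⟨q, hq, h0, h⟩
  filter_upwards [G.spread hq h0 h] with w ⟨h1, h2, h3⟩
  exact ⟨q, h1, h2, h3⟩

/-- The space with functions defined by local generators. -/
abbrev toFunctionSpace : FunctionSpace Z where
  toTopologicalSpace := G.topology
  RegularAt := G.Regular
  regularAt_const c z := ⟨algebraMap ℂ _ c, Subalgebra.algebraMap_mem _ c, 1, one_mem _, by simp,
    by simp⟩
  regularAt_add := by
    rintro f g z ⟨p, hp, q, hq, h0, h⟩ ⟨p', hp', q', hq', h0', h'⟩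
    refine ⟨p * q' + q * p', add_mem (mul_mem hp hq') (mul_mem hq hp'), q * q', mul_mem hq hq',
      mul_ne_zero h0 h0', ?_⟩
    filter_upwards [h, h'] with w h h' hw
    have h1 := left_ne_zero_of_mul hw
    have h2 := right_ne_zero_of_mul hw
    simp [h h1, h' h2, div_add_div _ _ h1 h2]
  regularAt_mul := by
    rintro f g z ⟨p, hp, q, hq, h0, h⟩ ⟨p', hp', q', hq', h0', h'⟩
    refine ⟨p * p', mul_mem hp hp', q * q', mul_mem hq hq', mul_ne_zero h0 h0', ?_⟩
    filter_upwards [h, h'] with w h h' hw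
    have h1 := left_ne_zero_of_mul hw
    have h2 := right_ne_zero_of_mul hw
    simp [h h1, h' h2, div_mul_div_comm]
  regularAt_inv := by
    rintro f z ⟨p, hp, q, hq, h0, h⟩ hf
    have hz := (G.pure_le z h : _) h0
    have hpz : p z ≠ 0 := fun h => hf (by simp [hz, h])
    refine ⟨q * q, mul_mem hq hq, p * q, mul_mem hp hq, mul_ne_zero hpz h0, ?_⟩
    filter_upwards [h] with w h hw
    have h2 := right_ne_zero_of_mul hw
    simp only [Pi.mul_apply, h h2, inv_div]
    rw [mul_div_mul_right _ _ h2]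
  regularAt_congr := by
    rintro f g z ⟨p, hp, q, hq, h0, h⟩ hg
    rw [nhds_eq] at hg
    obtain ⟨r, hr, hr0, hr'⟩ := hg
    refine ⟨p * r, mul_mem hp hr, q * r, mul_mem hq hr, mul_ne_zero h0 hr0, ?_⟩
    filter_upwards [h, hr'] with w h h' hw
    have h1 := left_ne_zero_of_mul hw
    have h2 := right_ne_zero_of_mul hw
    have h3 : g w = f w := h' h2
    simp only [Pi.mul_apply]
    rw [h3, h h1, mul_div_mul_right _ _ h2]
  regularAt_eventually := by
    rintro f z ⟨p, hp, q, hq, h0, h⟩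
    rw [nhds_eq]
    have := G.spread hq h0 (h.and (G.alg_eventually hp))
    filter_upwards [this] with w ⟨h1, h2, h3⟩
    exact ⟨p, (G.pure_le w h3 : _).2, q, h1, h2, h3.mono fun _ h => h.1⟩
  eventually_ne_zero := by
    rintro f z ⟨p, hp, q, hq, h0, h⟩ hf
    rw [nhds_eq]
    have hz := (G.pure_le z h : _) h0
    have hpz : p z ≠ 0 := fun h => hf (by simp [hz, h])
    refine ⟨p * q, mul_mem hp hq, mul_ne_zero hpz h0, ?_⟩
    filter_upwards [h] with w h hw
    have h1 := left_ne_zero_of_mul hw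
    have h2 := right_ne_zero_of_mul hw
    change f w ≠ 0
    rw [h h2]
    exact div_ne_zero h1 h2

end LocalGenerators

section RegularMaps

variable {X Y Z : Type} [FunctionSpace X] [FunctionSpace Y] [FunctionSpace Z]

lemma regularAt_sum {ι : Type} (s : Finset ι) {f : ι → X → ℂ} {x : X}
    (h : ∀ i ∈ s, RegularAt (f i) x) : RegularAt (fun y => ∑ i ∈ s, f i y) x := by
  classical
  induction s using Finset.induction_on with
  | empty => simpa using regularAt_const 0 x
  | insert a s ha ih =>
    simp only [Finset.sum_insert ha]
    exact regularAt_add (h a (by simp)) (ih fun i hi => h i (by simp [hi]))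

lemma regularAt_pow {f : X → ℂ} {x : X} (h : RegularAt f x) (k : ℕ) :
    RegularAt (fun y => f y ^ k) x := by
  induction k with
  | zero => simpa using regularAt_const 1 x
  | succ k ih => simpa only [pow_succ] using regularAt_mul ih h

lemma regularAt_zpow {f : X → ℂ} {x : X} (h : RegularAt f x) (h0 : f x ≠ 0) (k : ℤ) :
    RegularAt (fun y => f y ^ k) x := by
  cases k with
  | ofNat k => simpa using regularAt_pow h k
  | negSucc k =>
    simpa only [zpow_negSucc] using regularAt_inv (regularAt_pow h (k + 1)) (pow_ne_zero _ h0)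

/-- `φ` is a morphism near `x`: it is continuous at `x` and pulls back regular germs to regular
germs. -/
def RegularMapAt (φ : X → Y) (x : X) : Prop :=
  ContinuousAt φ x ∧ ∀ f, RegularAt f (φ x) → RegularAt (fun y => f (φ y)) x

/-- Morphisms of spaces with functions. -/
def RegularMap (φ : X → Y) : Prop := ∀ x, RegularMapAt φ x

lemma RegularMapAt.comp {ψ : Y → Z} {φ : X → Y} {x : X} (h : RegularMapAt ψ (φ x))
    (h' : RegularMapAt φ x) : RegularMapAt (fun y => ψ (φ y)) x :=
  ⟨ContinuousAt.comp (f := φ) (g := ψ) h.1 h'.1, fun f hf => h'.2 _ (h.2 f hf)⟩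

lemma regularMapAt_id (x : X) : RegularMapAt (fun y : X => y) x := ⟨continuousAt_id, fun _ h => h⟩

lemma RegularMapAt.congr {φ ψ : X → Y} {x : X} (h : RegularMapAt φ x)
    (h' : ∀ᶠ y in 𝓝 x, ψ y = φ y) : RegularMapAt ψ x := by
  have hx : ψ x = φ x := h'.self_of_nhds
  refine ⟨h.1.congr (h'.mono fun y hy => hy.symm), fun f hf => ?_⟩
  rw [hx] at hf
  exact regularAt_congr (h.2 f hf) (h'.mono fun y hy => by rw [hy])

end RegularMaps

/-- A criterion for a map into a space given by local generators to be a morphism. -/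
lemma LocalGenerators.regularMapAt {X Z : Type} [FunctionSpace X] (G : LocalGenerators Z)
    {φ : X → Z} {x : X} (hb : Tendsto φ (𝓝 x) (G.base (φ x)))
    (hg : ∀ f ∈ G.gen (φ x), RegularAt (fun y => f (φ y)) x) :
    let _ := G.toFunctionSpace
    RegularMapAt φ x := by
  let _ := G.toFunctionSpace
  have key : ∀ f ∈ G.alg (φ x), RegularAt (fun y => f (φ y)) x := by
    intro f hf
    induction hf using Algebra.adjoin_induction with
    | mem f hf => exact hg f hf
    | algebraMap r => exact regularAt_const r x
    | add f g _ _ hf hg => exact regularAt_add hf hg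
    | mul f g _ _ hf hg => exact regularAt_mul hf hg
  refine ⟨?_, ?_⟩
  · intro s hs
    rw [G.nhds_eq] at hs
    obtain ⟨q, hq, h0, h⟩ := hs
    change ∀ᶠ y in 𝓝 x, φ y ∈ s
    filter_upwards [hb h, eventually_ne_zero (key q hq) h0] with y h1 h2
    exact h1 h2
  · rintro f ⟨p, hp, q, hq, h0, h⟩
    refine regularAt_congr (regularAt_mul (key p hp) (regularAt_inv (key q hq) h0)) ?_
    filter_upwards [hb h, eventually_ne_zero (key q hq) h0] with y h1 h2
    rw [← div_eq_mul_inv]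
    exact h1 h2

/-! ### The spaces `V ∖ {0}`, `ℙ(V)` and `ℂˣ × X` -/

/-- `V ∖ {0}` for `V = ℂⁿ⁺¹`. -/
@[ext]
structure PuncturedSpace (n : ℕ) where
  val : Fin (n + 1) → ℂ
  ne_zero : val ≠ 0

variable {n : ℕ}

def PuncturedSpace.generators (n : ℕ) : LocalGenerators (PuncturedSpace n) where
  base _ := ⊤
  gen _ := Set.range fun (i : Fin (n + 1)) (v : PuncturedSpace n) => v.val i
  pure_le _ := le_top
  base_eventually := by rintro z s hs; simp_all
  gen_eventually _ _ hs := .of_forall fun _ => hs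

/-- `V ∖ {0}` with the Zariski topology; the regular functions are locally quotients of polynomials
in the coordinates. -/
instance : FunctionSpace (PuncturedSpace n) := (PuncturedSpace.generators n).toFunctionSpace

lemma regularAt_coord (i : Fin (n + 1)) (v : PuncturedSpace n) :
    RegularAt (fun w : PuncturedSpace n => w.val i) v :=
  ⟨_, Algebra.subset_adjoin ⟨i, rfl⟩, 1, one_mem _, by simp, by simp⟩

lemma regularMapAt_punctured {X : Type} [FunctionSpace X] {φ : X → PuncturedSpace n} {x : X}
    (h : ∀ i, RegularAt (fun y => (φ y).val i) x) : RegularMapAt φ x :=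
  (PuncturedSpace.generators n).regularMapAt tendsto_top (by rintro _ ⟨i, rfl⟩; exact h i)

/-- The product `ℂˣ × X`. -/
@[ext]
structure CstarProd (X : Type) where
  fst : ℂˣ
  snd : X

def CstarProd.generators (X : Type) [FunctionSpace X] : LocalGenerators (CstarProd X) where
  base z := comap CstarProd.snd (𝓝 z.snd)
  gen z := {fun w => (w.fst : ℂ)} ∪ {F | ∃ f, RegularAt f z.snd ∧ F = fun w => f w.snd}
  pure_le z := by
    rw [← tendsto_id', tendsto_comap_iff]
    exact tendsto_pure_nhds _ _
  base_eventually := by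
    rintro z s ⟨u, hu, hs⟩
    refine ⟨_, eventually_mem_nhds_iff.2 hu, fun w hw => ⟨u, hw, hs⟩⟩
  gen_eventually := by
    rintro z F (hF | ⟨f, hf, rfl⟩)
    · exact .of_forall fun w => Or.inl hF
    · refine ⟨_, regularAt_eventually hf, fun w hw => Or.inr ⟨f, hw, rfl⟩⟩

/-- The product variety `ℂˣ × X`: near `(t, x)`, the regular functions are quotients of polynomials
in the coordinate of `ℂˣ` whose coefficients are regular functions on `X` near `x`, and a
neighbourhood basis consists of the sets where such a polynomial does not vanish. -/
instance (X : Type) [FunctionSpace X] : FunctionSpace (CstarProd X) :=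
  (CstarProd.generators X).toFunctionSpace

section
variable {X Y : Type} [FunctionSpace X] [FunctionSpace Y]

lemma regularAt_fst (z : CstarProd X) : RegularAt (fun w : CstarProd X => (w.fst : ℂ)) z :=
  ⟨_, Algebra.subset_adjoin (Or.inl rfl), 1, one_mem _, by simp, by simp⟩

lemma regularAt_fst_zpow (z : CstarProd X) (k : ℤ) :
    RegularAt (fun w : CstarProd X => (w.fst : ℂ) ^ k) z :=
  regularAt_zpow (regularAt_fst z) z.fst.ne_zero k

lemma regularMapAt_snd (z : CstarProd X) : RegularMapAt (fun w : CstarProd X => w.snd) z := by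
  refine ⟨?_, fun f hf => ⟨_, Algebra.subset_adjoin (Or.inr ⟨f, hf, rfl⟩), 1, one_mem _, by simp,
    by simp⟩⟩
  intro s hs
  change _ ∈ 𝓝 z
  rw [(CstarProd.generators X).nhds_eq]
  exact ⟨1, one_mem _, by simp, s, hs, fun w hw _ => hw⟩

lemma regularMapAt_cstarProd {φ : Y → CstarProd X} {y : Y}
    (h1 : RegularAt (fun w => ((φ w).fst : ℂ)) y) (h2 : RegularMapAt (fun w => (φ w).snd) y) :
    RegularMapAt φ y :=
  (CstarProd.generators X).regularMapAt (tendsto_comap_iff.2 h2.1)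
    (by rintro _ (rfl | ⟨f, hf, rfl⟩); exacts [h1, h2.2 f hf])

end

/-- The projection `η : V ∖ {0} → ℙ(V)`. -/
def eta (v : PuncturedSpace n) : ℙ ℂ (Fin (n + 1) → ℂ) := Projectivization.mk ℂ v.val v.ne_zero

/-- An algebraic action of `ℂˣ` on `X`. -/
structure AlgAction (X : Type) [FunctionSpace X] extends MulAction ℂˣ X where
  regular : RegularMap fun z : CstarProd X => smul z.fst z.snd

/-- The action of `ℂˣ` on `V ∖ {0}` through the diagonal matrices `diag (t ^ d 0, …, t ^ d n)`. -/
def weightAction (d : Fin (n + 1) → ℕ) : AlgAction (PuncturedSpace n) where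
  smul t v := ⟨fun i => (t : ℂ) ^ d i * v.val i, fun h => v.ne_zero (funext fun i => by
    simpa using congrFun h i)⟩
  one_smul v := by ext i; simp [HSMul.hSMul]
  mul_smul t t' v := by ext i; simp [HSMul.hSMul, mul_pow, mul_assoc]
  regular z := regularMapAt_punctured fun i => regularAt_mul (regularAt_pow (regularAt_fst z) _)
    ((regularMapAt_snd z).2 _ (regularAt_coord i _))

/-- The action of `ℂˣ` on `V ∖ {0}` by scalar multiplication. -/
def scalarAction (n : ℕ) : AlgAction (PuncturedSpace n) := weightAction fun _ => 1

@[simp] lemma weightAction_val (d : Fin (n + 1) → ℕ) (t : ℂˣ) (v : PuncturedSpace n)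
    (i : Fin (n + 1)) : ((weightAction d).smul t v).val i = (t : ℂ) ^ d i * v.val i := rfl

@[simp] lemma scalarAction_val (t : ℂˣ) (v : PuncturedSpace n)
    (i : Fin (n + 1)) : ((scalarAction n).smul t v).val i = t * v.val i := by
  change (t : ℂ) ^ 1 * v.val i = t * v.val i
  rw [pow_one]

lemma AlgAction.one_smul' {X : Type} [FunctionSpace X] (a : AlgAction X) (x : X) :
    a.smul 1 x = x := a.one_smul x

lemma AlgAction.mul_smul' {X : Type} [FunctionSpace X] (a : AlgAction X) (t t' : ℂˣ) (x : X) :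
    a.smul (t * t') x = a.smul t (a.smul t' x) := a.mul_smul t t' x

lemma AlgAction.smul_eq_iff {X : Type} [FunctionSpace X] (a : AlgAction X) {t : ℂˣ} {x y : X} :
    a.smul t x = y ↔ x = a.smul t⁻¹ y := by
  constructor
  · rintro rfl; rw [← a.mul_smul', inv_mul_cancel, a.one_smul']
  · rintro rfl; rw [← a.mul_smul', mul_inv_cancel, a.one_smul']

lemma AlgAction.regularMapAt_smul {X : Type} [FunctionSpace X] (a : AlgAction X) (t : ℂˣ) (x : X) :
    RegularMapAt (a.smul t) x :=
  RegularMapAt.comp (φ := fun y => CstarProd.mk t y) (a.regular ⟨t, x⟩)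
    (regularMapAt_cstarProd (regularAt_const (t : ℂ) x) (regularMapAt_id x))

lemma eta_eq_iff {v w : PuncturedSpace n} :
    eta v = eta w ↔ ∃ t, (scalarAction n).smul t v = w := by
  rw [eta, eta, eq_comm, Projectivization.mk_eq_mk_iff]
  refine exists_congr fun t => ?_
  rw [PuncturedSpace.ext_iff]
  constructor <;> intro h <;> funext i <;> have := congrFun h i <;>
    simpa [Units.smul_def] using this

@[simp] lemma eta_smul (t : ℂˣ) (v : PuncturedSpace n) :
    eta ((scalarAction n).smul t v) = eta v := (eta_eq_iff.2 ⟨t, rfl⟩).symm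

/-- A chosen point of `V ∖ {0}` over a point of `ℙ(V)`. -/
def lift (x : ℙ ℂ (Fin (n + 1) → ℂ)) : PuncturedSpace n := ⟨x.rep, x.rep_nonzero⟩

@[simp] lemma eta_lift (x : ℙ ℂ (Fin (n + 1) → ℂ)) : eta (lift x) = x := x.mk_rep

lemma eta_surjective : Function.Surjective (eta (n := n)) := fun x => ⟨lift x, eta_lift x⟩

/-- The Zariski topology of `ℙ(V)`: the quotient topology. -/
abbrev projTopology (n : ℕ) : TopologicalSpace (ℙ ℂ (Fin (n + 1) → ℂ)) :=
  TopologicalSpace.coinduced eta inferInstance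

lemma map_nhds_eta (v : PuncturedSpace n) :
    map eta (𝓝 v) = @nhds _ (projTopology n) (eta v) := by
  let _ := projTopology n
  refine IsOpenQuotientMap.map_nhds_eq ⟨eta_surjective, continuous_coinduced_rng, ?_⟩ v
  intro U hU
  rw [isOpen_coinduced]
  have : eta ⁻¹' (eta '' U) = ⋃ t, (scalarAction n).smul t ⁻¹' U := by
    ext w
    simp only [Set.mem_preimage, Set.mem_image, Set.mem_iUnion]
    constructor
    · rintro ⟨u, hu, h⟩
      obtain ⟨t, rfl⟩ := eta_eq_iff.1 h.symm
      exact ⟨t, hu⟩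
    · rintro ⟨t, ht⟩
      exact ⟨_, ht, by simp⟩
  rw [this]
  refine isOpen_iUnion fun t => hU.preimage ?_
  exact continuous_iff_continuousAt.2 fun w => ((scalarAction n).regularMapAt_smul t w).1

lemma regularAt_eta_of_regularAt {f : ℙ ℂ (Fin (n + 1) → ℂ) → ℂ} {v w : PuncturedSpace n}
    (hvw : eta v = eta w) (h : RegularAt (fun u => f (eta u)) v) :
    RegularAt (fun u => f (eta u)) w := by
  obtain ⟨t, rfl⟩ := eta_eq_iff.1 hvw.symm
  simpa using ((scalarAction n).regularMapAt_smul t w).2 _ h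

/-- `ℙ(V)` as a space with functions: a function is regular if its pull back to the cone
`V ∖ {0}` is regular. -/
instance : FunctionSpace (ℙ ℂ (Fin (n + 1) → ℂ)) where
  toTopologicalSpace := projTopology n
  RegularAt f x := ∀ v, eta v = x → RegularAt (fun w => f (eta w)) v
  regularAt_const c x v hv := regularAt_const c v
  regularAt_add hf hg v hv := regularAt_add (hf v hv) (hg v hv)
  regularAt_mul hf hg v hv := regularAt_mul (hf v hv) (hg v hv)
  regularAt_inv := by
    rintro f x hf h0 v rfl
    exact regularAt_inv (hf v rfl) h0
  regularAt_congr := by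
    rintro f g x hf h v rfl
    rw [← map_nhds_eta, eventually_map] at h
    exact regularAt_congr (hf v rfl) h
  regularAt_eventually := by
    rintro f x hf
    obtain ⟨v, rfl⟩ := eta_surjective x
    rw [← map_nhds_eta, eventually_map]
    filter_upwards [regularAt_eventually (hf v rfl)] with w hw u hu
    exact regularAt_eta_of_regularAt hu.symm hw
  eventually_ne_zero := by
    rintro f x hf h0
    obtain ⟨v, rfl⟩ := eta_surjective x
    rw [← map_nhds_eta, eventually_map]
    exact eventually_ne_zero (hf v rfl) h0

lemma nhds_eta (v : PuncturedSpace n) : 𝓝 (eta v) = map eta (𝓝 v) := (map_nhds_eta v).symm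

lemma regularAt_eta {f : ℙ ℂ (Fin (n + 1) → ℂ) → ℂ} {v : PuncturedSpace n} :
    RegularAt f (eta v) ↔ RegularAt (fun u => f (eta u)) v :=
  ⟨fun h => h v rfl, fun h _ hw => regularAt_eta_of_regularAt hw.symm h⟩

lemma regularMap_eta : RegularMap (eta (n := n)) := fun v =>
  ⟨(nhds_eta v).ge, fun _ h => regularAt_eta.1 h⟩

lemma regularMapAt_of_comp_eta {Y : Type} [FunctionSpace Y] {φ : ℙ ℂ (Fin (n + 1) → ℂ) → Y}
    {v : PuncturedSpace n} (h : RegularMapAt (fun w => φ (eta w)) v) : RegularMapAt φ (eta v) :=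
  ⟨by rw [ContinuousAt, nhds_eta, tendsto_map'_iff]; exact h.1,
    fun f hf => regularAt_eta.2 (h.2 f hf)⟩

/-- `τ` is a local section of `η` near `x`, and `w = u(w) τ(η(w))` on the cone over `x`. -/
def IsSectionAt (τ : ℙ ℂ (Fin (n + 1) → ℂ) → PuncturedSpace n) (u : PuncturedSpace n → ℂˣ)
    (x : ℙ ℂ (Fin (n + 1) → ℂ)) : Prop :=
  eta (τ x) = x ∧ RegularMapAt τ x ∧ ∀ w, eta w = x →
    (scalarAction n).smul (u w) (τ x) = w ∧ RegularAt (fun w' => (u w' : ℂ)) w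

lemma exists_local_section (v₀ : PuncturedSpace n) :
    ∃ (τ : ℙ ℂ (Fin (n + 1) → ℂ) → PuncturedSpace n) (u : PuncturedSpace n → ℂˣ),
      τ (eta v₀) = v₀ ∧ ∀ᶠ x in 𝓝 (eta v₀), IsSectionAt τ u x := by
  classical
  obtain ⟨i, hi⟩ : ∃ i, v₀.val i ≠ 0 := by
    by_contra! h
    exact v₀.ne_zero (funext h)
  let c : PuncturedSpace n → ℂˣ := fun w =>
    if h : w.val i ≠ 0 then Units.mk0 (v₀.val i / w.val i) (div_ne_zero hi h) else 1
  have hc : ∀ w, w.val i ≠ 0 → (c w : ℂ) = v₀.val i / w.val i := fun w hw => by simp [c, hw]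
  let τ : ℙ ℂ (Fin (n + 1) → ℂ) → PuncturedSpace n :=
    fun x => (scalarAction n).smul (c (lift x)) (lift x)
  have hτ : ∀ w, w.val i ≠ 0 → τ (eta w) = (scalarAction n).smul (c w) w := by
    intro w hw
    obtain ⟨t, ht⟩ := eta_eq_iff.1 (eta_lift (eta w)).symm
    have hne : (lift (eta w)).val i ≠ 0 := by rw [← ht]; simp [hw]
    ext j
    simp only [τ, scalarAction_val, hc _ hw, hc _ hne]
    rw [← ht]
    have := t.ne_zero
    simp only [scalarAction_val]
    field_simp
  have hopen : ∀ w : PuncturedSpace n, w.val i ≠ 0 → ∀ᶠ w' in 𝓝 w, w'.val i ≠ 0 :=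
    fun w hw => eventually_ne_zero (regularAt_coord i w) hw
  refine ⟨τ, fun w => (c w)⁻¹, ?_, ?_⟩
  · rw [hτ _ hi]
    ext j
    simp [hc _ hi, hi]
  · rw [nhds_eta, eventually_map]
    filter_upwards [hopen v₀ hi] with w hw
    refine ⟨by simp [τ], ?_, ?_⟩
    · refine regularMapAt_of_comp_eta (RegularMapAt.congr
        (φ := fun w => (scalarAction n).smul (c w) w) ?_ ((hopen w hw).mono hτ))
      refine regularMapAt_punctured fun j => ?_
      simp only [scalarAction_val]
      refine regularAt_mul (regularAt_congr (f := fun w => v₀.val i * (w.val i)⁻¹) ?_ ?_)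
        (regularAt_coord j w)
      · exact regularAt_mul (regularAt_const _ _) (regularAt_inv (regularAt_coord i w) hw)
      · exact (hopen w hw).mono fun w' h => by rw [hc _ h, div_eq_mul_inv]
    · intro w' hw'
      have hw'i : w'.val i ≠ 0 := by
        obtain ⟨t, rfl⟩ := eta_eq_iff.1 hw'.symm
        simp [hw]
      rw [← hw', hτ _ hw'i, ← AlgAction.mul_smul', inv_mul_cancel, AlgAction.one_smul']
      refine ⟨rfl, regularAt_congr (f := fun w => (v₀.val i)⁻¹ * w.val i) ?_ ?_⟩
      · exact regularAt_mul (regularAt_const _ _) (regularAt_coord i w')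
      · refine (hopen w' hw'i).mono fun w' h => ?_
        simp only [Units.val_inv_eq_inv_val]
        rw [hc _ h, inv_div, div_eq_inv_mul]

/-- The trivial action of `ℂˣ`. -/
def trivialAction (X : Type) [FunctionSpace X] : AlgAction X where
  smul _ x := x
  one_smul _ := rfl
  mul_smul _ _ _ := rfl
  regular z := regularMapAt_snd z

lemma eta_weightAction_congr (d : Fin (n + 1) → ℕ) (t : ℂˣ) {v w : PuncturedSpace n}
    (h : eta v = eta w) : eta ((weightAction d).smul t v) = eta ((weightAction d).smul t w) := by
  obtain ⟨s, rfl⟩ := eta_eq_iff.1 h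
  refine eta_eq_iff.2 ⟨s, ?_⟩
  ext i
  simp [mul_left_comm]

/-- The action of `ℂˣ` on `ℙ(V)` induced by `weightAction d`. -/
def projWeightAction (d : Fin (n + 1) → ℕ) : AlgAction (ℙ ℂ (Fin (n + 1) → ℂ)) where
  smul t x := eta ((weightAction d).smul t (lift x))
  one_smul x := by
    change eta ((weightAction d).smul 1 (lift x)) = x
    rw [AlgAction.one_smul', eta_lift]
  mul_smul t t' x := by
    change eta ((weightAction d).smul (t * t') (lift x)) = eta ((weightAction d).smul t _)
    rw [AlgAction.mul_smul']
    exact eta_weightAction_congr d t (by rw [eta_lift]; rfl)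
  regular := by
    rintro ⟨t, x⟩
    obtain ⟨v, rfl⟩ := eta_surjective x
    obtain ⟨τ, u, h0, h⟩ := exists_local_section v
    have h' := (regularMapAt_snd (CstarProd.mk t (eta v))).1.eventually h
    refine RegularMapAt.congr
      (φ := fun z : CstarProd _ => eta ((weightAction d).smul z.fst (τ z.snd))) ?_ ?_
    · refine (regularMap_eta _).comp (RegularMapAt.comp
        (ψ := fun z : CstarProd _ => (weightAction d).smul z.fst z.snd)
        (φ := fun z : CstarProd _ => CstarProd.mk z.fst (τ z.snd))
        ((weightAction d).regular ⟨t, τ (eta v)⟩) ?_)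
      exact regularMapAt_cstarProd (regularAt_fst _)
        (RegularMapAt.comp (φ := fun z : CstarProd _ => z.snd) h.self_of_nhds.2.1
          (regularMapAt_snd (CstarProd.mk t (eta v))))
    · filter_upwards [h'] with z hz
      exact eta_weightAction_congr d _ (by rw [eta_lift, hz.1])

lemma eta_weightAction (d : Fin (n + 1) → ℕ) (t : ℂˣ) (v : PuncturedSpace n) :
    eta ((weightAction d).smul t v) = (projWeightAction d).smul t (eta v) :=
  eta_weightAction_congr d t (eta_lift _).symm
/-! ### Algebraic vector bundles -/

/-- Let `Fiber` be a family of vector spaces over `X` and let `R s y` say which set theoretic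
sections `s` are regular near which point `y`. The sections `e i` form a frame at `y` if their values
at `y` form a basis of the fibre, and if the germs at `y` of regular sections are exactly the
combinations of the `e i` with regular coefficients. -/
def IsFrameAt {X : Type} [FunctionSpace X] {Fiber : X → Type} [∀ x, AddCommGroup (Fiber x)]
    [∀ x, Module ℂ (Fiber x)] (R : (∀ x, Fiber x) → X → Prop) {ι : Type} [Fintype ι]
    (e : ι → ∀ x, Fiber x) (y : X) : Prop :=
  (∃ b : Module.Basis ι ℂ (Fiber y), ∀ i, b i = e i y) ∧
    ∀ s, R s y ↔ ∃ c : ι → X → ℂ, (∀ i, RegularAt (c i) y) ∧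
      ∀ᶠ z in 𝓝 y, s z = ∑ i, c i z • e i z

/-- An algebraic vector bundle on `X`, of finite and locally constant rank: a family of complex
vector spaces, together with the datum of which (set theoretic) sections are regular near which
point, that has a frame in a neighbourhood of each point. -/
structure VectorBundle (X : Type) [FunctionSpace X] where
  Fiber : X → Type
  [grp : ∀ x, AddCommGroup (Fiber x)]
  [mod : ∀ x, Module ℂ (Fiber x)]
  RegAt : (∀ x, Fiber x) → X → Prop
  exists_frame : ∀ x, ∃ (ι : Type) (_ : Fintype ι) (e : ι → ∀ y, Fiber y),
    ∀ᶠ y in 𝓝 x, IsFrameAt RegAt e y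

attribute [instance] VectorBundle.grp VectorBundle.mod

namespace VectorBundle

variable {X Y : Type} [FunctionSpace X] [FunctionSpace Y]

lemma frame_regAt {E : VectorBundle X} {ι : Type} [Fintype ι] {e : ι → ∀ y, E.Fiber y} {x : X}
    (h : IsFrameAt E.RegAt e x) (i : ι) : E.RegAt (e i) x := by
  classical
  refine (h.2 _).2 ⟨fun j _ => if j = i then 1 else 0, fun j => regularAt_const _ _, ?_⟩
  exact .of_forall fun z => by simp

lemma regAt_congr {E : VectorBundle X} {s s' : ∀ x, E.Fiber x} {x : X} (h : E.RegAt s x)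
    (h' : ∀ᶠ y in 𝓝 x, s' y = s y) : E.RegAt s' x := by
  obtain ⟨ι, _, e, he⟩ := E.exists_frame x
  obtain ⟨c, hc, hs⟩ := (he.self_of_nhds.2 s).1 h
  exact (he.self_of_nhds.2 s').2 ⟨c, hc, by filter_upwards [h', hs] with y h1 h2; rw [h1, h2]⟩

lemma regAt_sum {E : VectorBundle X} {κ : Type} [Fintype κ] {c : κ → X → ℂ}
    {s : κ → ∀ x, E.Fiber x} {x : X} (hc : ∀ k, RegularAt (c k) x) (hs : ∀ k, E.RegAt (s k) x) :
    E.RegAt (fun y => ∑ k, c k y • s k y) x := by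
  obtain ⟨ι, _, e, he⟩ := E.exists_frame x
  choose d hd hsd using fun k => (he.self_of_nhds.2 (s k)).1 (hs k)
  refine (he.self_of_nhds.2 _).2 ⟨fun i y => ∑ k, c k y * d k i y, fun i =>
    regularAt_sum _ fun k _ => regularAt_mul (hc k) (hd k i), ?_⟩
  filter_upwards [eventually_all.2 hsd] with y hy
  simp only [hy, Finset.smul_sum, Finset.sum_smul, mul_smul]
  exact Finset.sum_comm

lemma regAt_smul {E : VectorBundle X} {c : X → ℂ}
    {s : ∀ x, E.Fiber x} {x : X} (hc : RegularAt c x) (hs : E.RegAt s x) :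
    E.RegAt (fun y => c y • s y) x := by
  simpa using regAt_sum (κ := Unit) (fun _ => hc) (fun _ => hs)

/-- A morphism of algebraic vector bundles: a family of linear maps taking regular sections to
regular sections. -/
@[ext]
structure Hom (E F : VectorBundle X) where
  map : ∀ x, E.Fiber x →ₗ[ℂ] F.Fiber x
  regular : ∀ s x, E.RegAt s x → F.RegAt (fun y => map y (s y)) x

instance : Category (VectorBundle X) where
  Hom := Hom
  id E := ⟨fun _ => LinearMap.id, fun _ _ h => h⟩
  comp f g := ⟨fun x => g.map x ∘ₗ f.map x, fun s x h => g.regular _ x (f.regular s x h)⟩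

@[simp] lemma id_map (E : VectorBundle X) (x : X) : Hom.map (𝟙 E) x = LinearMap.id := rfl

@[simp] lemma comp_map {E F G : VectorBundle X} (f : E ⟶ F) (g : F ⟶ G) (x : X) :
    Hom.map (f ≫ g) x = g.map x ∘ₗ f.map x := rfl

@[ext] lemma hom_ext {E F : VectorBundle X} {f g : E ⟶ F} (h : ∀ x v, f.map x v = g.map x v) :
    f = g := Hom.ext (funext fun x => LinearMap.ext (h x))

/-- The regular sections near `x` of the pull back of `E` along `φ`: combinations of pull backs of
regular sections, with regular coefficients. -/
def PullbackRegAt (φ : X → Y) (E : VectorBundle Y) (s : ∀ x, E.Fiber (φ x)) (x : X) : Prop :=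
  ∃ (κ : Type) (_ : Fintype κ) (c : κ → X → ℂ) (e : κ → ∀ y, E.Fiber y),
    (∀ k, RegularAt (c k) x) ∧ (∀ k, E.RegAt (e k) (φ x)) ∧
      ∀ᶠ z in 𝓝 x, s z = ∑ k, c k z • e k (φ z)

lemma pullbackRegAt_iff {φ : X → Y} {x : X} (hφ : RegularMapAt φ x) {E : VectorBundle Y}
    {ι : Type} [Fintype ι] {e : ι → ∀ y, E.Fiber y} (he : IsFrameAt E.RegAt e (φ x))
    (s : ∀ x, E.Fiber (φ x)) : PullbackRegAt φ E s x ↔ ∃ c : ι → X → ℂ, (∀ i, RegularAt (c i) x) ∧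
      ∀ᶠ z in 𝓝 x, s z = ∑ i, c i z • e i (φ z) := by
  constructor
  · rintro ⟨κ, _, c, f, hc, hf, hs⟩
    choose d hd hfd using fun k => (he.2 (f k)).1 (hf k)
    refine ⟨fun i z => ∑ k, c k z * d k i (φ z), fun i =>
      regularAt_sum _ fun k _ => regularAt_mul (hc k) (hφ.2 _ (hd k i)), ?_⟩
    filter_upwards [hs, hφ.1.eventually (eventually_all.2 hfd)] with z h1 h2
    simp only [h1, h2, Finset.smul_sum, Finset.sum_smul, mul_smul]
    exact Finset.sum_comm
  · rintro ⟨c, hc, hs⟩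
    exact ⟨ι, inferInstance, c, e, hc, frame_regAt he, hs⟩

/-- The pull back `φ^* E`. -/
def pullbackObj (φ : X → Y) (hφ : RegularMap φ) (E : VectorBundle Y) : VectorBundle X where
  Fiber x := E.Fiber (φ x)
  RegAt := PullbackRegAt φ E
  exists_frame x := by
    obtain ⟨ι, _, e, he⟩ := E.exists_frame (φ x)
    refine ⟨ι, inferInstance, fun i y => e i (φ y), ?_⟩
    filter_upwards [(hφ x).1.eventually he] with y hy
    exact ⟨hy.1, pullbackRegAt_iff (hφ y) hy⟩

lemma PullbackRegAt.map {φ : X → Y} {E F : VectorBundle Y} (f : E ⟶ F)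
    {s : ∀ x, E.Fiber (φ x)} {x : X} (h : PullbackRegAt φ E s x) :
    PullbackRegAt φ F (fun x => f.map (φ x) (s x)) x := by
  obtain ⟨κ, _, c, e, hc, he, hs⟩ := h
  refine ⟨κ, inferInstance, c, fun k y => f.map y (e k y), hc, fun k => f.regular _ _ (he k), ?_⟩
  filter_upwards [hs] with z hz
  simp [hz]

/-- The functor `φ^*`. -/
def pullback (φ : X → Y) (hφ : RegularMap φ) : VectorBundle Y ⥤ VectorBundle X where
  obj := pullbackObj φ hφ
  map f := ⟨fun x => f.map (φ x), fun _ _ h => h.map f⟩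

/-- The tensor product of two vector bundles. Its regular sections are locally the finite sums of
tensors of regular sections. -/
def tensorObj (E F : VectorBundle X) : VectorBundle X where
  Fiber x := E.Fiber x ⊗[ℂ] F.Fiber x
  RegAt s x := ∃ (κ : Type) (_ : Fintype κ) (e : κ → ∀ y, E.Fiber y) (f : κ → ∀ y, F.Fiber y),
    (∀ k, E.RegAt (e k) x) ∧ (∀ k, F.RegAt (f k) x) ∧
      ∀ᶠ z in 𝓝 x, s z = ∑ k, e k z ⊗ₜ[ℂ] f k z
  exists_frame x := by
    obtain ⟨ι, _, e, he⟩ := E.exists_frame x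
    obtain ⟨κ, _, f, hf⟩ := F.exists_frame x
    refine ⟨ι × κ, inferInstance, fun i y => e i.1 y ⊗ₜ f i.2 y, ?_⟩
    filter_upwards [he, hf] with y he hf
    refine ⟨?_, fun s => ⟨?_, ?_⟩⟩
    · obtain ⟨b, hb⟩ := he.1
      obtain ⟨b', hb'⟩ := hf.1
      exact ⟨b.tensorProduct b', fun i => by
        rw [Module.Basis.tensorProduct_apply', hb, hb']⟩
    · rintro ⟨ν, _, u, v, hu, hv, hs⟩
      choose c hc huc using fun k => (he.2 (u k)).1 (hu k)
      choose d hd hvd using fun k => (hf.2 (v k)).1 (hv k)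
      refine ⟨fun i z => ∑ k, c k i.1 z * d k i.2 z, fun i =>
        regularAt_sum _ fun k _ => regularAt_mul (hc k _) (hd k _), ?_⟩
      filter_upwards [hs, eventually_all.2 huc, eventually_all.2 hvd] with z h1 h2 h3
      simp only [h1, h2, h3, TensorProduct.sum_tmul, TensorProduct.tmul_sum,
        TensorProduct.smul_tmul_smul, Finset.sum_smul, Fintype.sum_prod_type]
      exact (Finset.sum_congr rfl fun k _ => Finset.sum_comm).trans
        (Finset.sum_comm.trans (Finset.sum_congr rfl fun i _ => Finset.sum_comm))
    · rintro ⟨c, hc, hs⟩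
      refine ⟨ι × κ, inferInstance, fun i z => c i z • e i.1 z, fun i => f i.2,
        fun i => regAt_smul (hc i) (frame_regAt he _), fun i => frame_regAt hf _, ?_⟩
      filter_upwards [hs] with z hz
      simp [hz, TensorProduct.smul_tmul']

/-- The functor `E ↦ E ⊗ F`. -/
def tensorRight (F : VectorBundle X) : VectorBundle X ⥤ VectorBundle X where
  obj E := tensorObj E F
  map f := ⟨fun x => (f.map x).rTensor (F.Fiber x), by
    rintro s x ⟨κ, _, u, v, hu, hv, hs⟩
    refine ⟨κ, inferInstance, fun k y => f.map y (u k y), v, fun k => f.regular _ _ (hu k), hv, ?_⟩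
    filter_upwards [hs] with z hz
    refine (congrArg ((f.map z).rTensor (F.Fiber z)) hz).trans ?_
    exact map_sum ((f.map z).rTensor (F.Fiber z)) _ _⟩
  map_id E := by
    refine Hom.ext (funext fun x => ?_)
    exact LinearMap.rTensor_id _ _
  map_comp f g := by
    refine Hom.ext (funext fun x => ?_)
    exact LinearMap.rTensor_comp _ _ _

end VectorBundle
/-! ### Vector bundles with a `ℂˣ`-linearization -/

/-- A vector bundle on `X` with an algebraic `ℂˣ`-action above the action `a` of `ℂˣ` on `X`. The
action of `t` is given by linear maps `E_x → E_y` for `y = t x`. It is algebraic: for a regular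
section `s`, the section `(t, x) ↦ t s(x)` of the pull back of `E` by the action map
`ℂˣ × X → X` is regular. -/
structure LinearizedBundle {X : Type} [FunctionSpace X] (a : AlgAction X)
    extends VectorBundle X where
  act : ∀ (t : ℂˣ) {x y : X}, a.smul t x = y → (Fiber x →ₗ[ℂ] Fiber y)
  act_one : ∀ {x : X} (h : a.smul 1 x = x) (v : Fiber x), act 1 h v = v
  act_mul : ∀ (t t' : ℂˣ) {x y z : X} (h : a.smul t' x = y) (h' : a.smul t y = z)
    (h'' : a.smul (t * t') x = z) (v : Fiber x), act (t * t') h'' v = act t h' (act t' h v)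
  act_regular : ∀ s x t, RegAt s x → toVectorBundle.PullbackRegAt
    (fun z : CstarProd X => a.smul z.fst z.snd) (fun z => act z.fst rfl (s z.snd)) ⟨t, x⟩

namespace LinearizedBundle

variable {X Y : Type} [FunctionSpace X] [FunctionSpace Y] {a : AlgAction X} {b : AlgAction Y}

/-- The `ℂˣ`-equivariant morphisms. -/
@[ext]
structure Hom (E F : LinearizedBundle a) where
  hom : E.toVectorBundle ⟶ F.toVectorBundle
  equivariant : ∀ (t : ℂˣ) {x y : X} (h : a.smul t x = y) (v : E.Fiber x),
    hom.map y (E.act t h v) = F.act t h (hom.map x v)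

instance : Category (LinearizedBundle a) where
  Hom := Hom
  id E := ⟨𝟙 _, fun _ _ _ _ _ => rfl⟩
  comp f g := ⟨f.hom ≫ g.hom, fun t x y h v => by
    simp [f.equivariant, g.equivariant]⟩

@[simp] lemma id_hom (E : LinearizedBundle a) : Hom.hom (𝟙 E) = 𝟙 _ := rfl

@[simp] lemma comp_hom {E F G : LinearizedBundle a} (f : E ⟶ F) (g : F ⟶ G) :
    Hom.hom (f ≫ g) = f.hom ≫ g.hom := rfl

@[ext] lemma hom_ext {E F : LinearizedBundle a} {f g : E ⟶ F} (h : f.hom = g.hom) : f = g :=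
  Hom.ext h

/-- The bundle `E^{(q)}`: the same vector bundle, with the action multiplied by the character
`t ^ q`. -/
def twistObj (q : ℤ) (E : LinearizedBundle a) : LinearizedBundle a where
  toVectorBundle := E.toVectorBundle
  act t _ _ h := ((t : ℂ) ^ q) • E.act t h
  act_one h v := by simp [E.act_one]
  act_mul t t' x y z h h' h'' v := by
    simp [E.act_mul t t' h h', mul_zpow, mul_smul, smul_comm ((t : ℂ) ^ q)]
  act_regular s x t hs := by
    obtain ⟨κ, _, c, e, hc, he, h⟩ := E.act_regular s x t hs
    refine ⟨κ, inferInstance, fun k z => (z.fst : ℂ) ^ q * c k z, e,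
      fun k => regularAt_mul (regularAt_fst_zpow _ q) (hc k), he, ?_⟩
    filter_upwards [h] with z hz
    simp [hz, Finset.smul_sum, mul_smul]

/-- The functor `E ↦ E^{(q)}`. -/
def twist (q : ℤ) : LinearizedBundle a ⥤ LinearizedBundle a where
  obj := twistObj q
  map f := ⟨f.hom, fun t x y h v => by
    exact (map_smul (f.hom.map y) _ _).trans (congrArg _ (f.equivariant t h v))⟩

/-- The pull back `φ^* E` along an equivariant morphism, with the action `E_{φ x} → E_{φ (t x)}`. -/
def pullbackObj (φ : X → Y) (hφ : RegularMap φ)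
    (hab : ∀ t x, φ (a.smul t x) = b.smul t (φ x)) (E : LinearizedBundle b) :
    LinearizedBundle a where
  toVectorBundle := E.toVectorBundle.pullbackObj φ hφ
  act t x y h := E.act t (x := φ x) (y := φ y) (by rw [← hab, h])
  act_one h v := E.act_one _ v
  act_mul t t' x y z h h' h'' v := E.act_mul t t' _ _ _ v
  act_regular s x t hs := by
    obtain ⟨κ, _, c, e, hc, he, hs⟩ := hs
    choose ι hι d f hd hf hef using fun k => E.act_regular (e k) (φ x) t (he k)
    have hΦ : RegularMapAt (fun z : CstarProd X => CstarProd.mk z.fst (φ z.snd)) ⟨t, x⟩ :=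
      regularMapAt_cstarProd (regularAt_fst _)
        (RegularMapAt.comp (φ := fun z : CstarProd X => z.snd) (hφ x) (regularMapAt_snd _))
    refine ⟨Σ k, ι k, inferInstance,
      fun i z => c i.1 z.snd * d i.1 i.2 ⟨z.fst, φ z.snd⟩, fun i y => f i.1 i.2 (φ y),
      fun i => regularAt_mul ((regularMapAt_snd _).2 _ (hc i.1)) (hΦ.2 _ (hd i.1 i.2)),
      fun i => ?_, ?_⟩
    · refine ⟨Unit, inferInstance, fun _ _ => 1, fun _ => f i.1 i.2,
        fun _ => regularAt_const _ _, fun _ => ?_, .of_forall fun z => by simp⟩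
      rw [hab]
      exact hf i.1 i.2
    · filter_upwards [(regularMapAt_snd (CstarProd.mk t x)).1.eventually hs,
        hΦ.1.eventually (eventually_all.2 hef)] with z h1 h2
      have key : ∀ k (y : Y) (h : b.smul z.fst (φ z.snd) = y),
          E.act z.fst h (e k (φ z.snd)) = ∑ i, d k i ⟨z.fst, φ z.snd⟩ • f k i y := by
        rintro k y rfl
        exact h2 k
      have h1' : s z.snd = ∑ k, c k z.snd • e k (φ z.snd) := h1
      have hz : E.act z.fst (x := φ z.snd) (y := φ (a.smul z.fst z.snd)) (hab _ _).symm (s z.snd) =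
          ∑ i : Σ k, ι k, (c i.1 z.snd * d i.1 i.2 ⟨z.fst, φ z.snd⟩) •
            f i.1 i.2 (φ (a.smul z.fst z.snd)) := by
        rw [h1', map_sum, Fintype.sum_sigma]
        refine Finset.sum_congr rfl fun k _ => ?_
        rw [map_smul, key, Finset.smul_sum]
        exact Finset.sum_congr rfl fun i _ => (mul_smul _ _ _).symm
      exact hz

/-- The functor `φ^*` on linearized bundles, for an equivariant morphism `φ`. -/
def pullback (φ : X → Y) (hφ : RegularMap φ)
    (hab : ∀ t x, φ (a.smul t x) = b.smul t (φ x)) : LinearizedBundle b ⥤ LinearizedBundle a where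
  obj := pullbackObj φ hφ hab
  map f := ⟨(VectorBundle.pullback φ hφ).map f.hom, fun t x y h v => f.equivariant t _ v⟩

/-- A vector bundle on `X` with the trivial `ℂˣ`-action, above the trivial action on `X`. -/
def trivialObj (E : VectorBundle X) : LinearizedBundle (trivialAction X) where
  toVectorBundle := E
  act t x y h := (LinearEquiv.cast (R := ℂ) (M := E.Fiber) (show x = y from h)).toLinearMap
  act_one h v := rfl
  act_mul t t' x y z h h' h'' v := by
    obtain rfl : x = y := h
    obtain rfl : x = z := h'
    rfl
  act_regular s x t hs := ⟨Unit, inferInstance, fun _ _ => 1, fun _ => s,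
    fun _ => regularAt_const _ _, fun _ => hs, .of_forall fun z => by simp; rfl⟩

def trivial (X : Type) [FunctionSpace X] :
    VectorBundle X ⥤ LinearizedBundle (trivialAction X) where
  obj := trivialObj
  map f := ⟨f, fun t x y h v => by
    obtain rfl : x = y := h
    rfl⟩

end LinearizedBundle
/-! ### The line bundles `𝒪(q)` -/

/-- The fibre of `𝒪(q)` at a line `x`, that is, `x^{-q}`: the functions on `x ∖ {0}` that are
homogeneous of degree `q`. -/
def serreFiber (q : ℤ) (x : ℙ ℂ (Fin (n + 1) → ℂ)) :
    Submodule ℂ ({v : PuncturedSpace n // eta v = x} → ℂ) where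
  carrier := {φ | ∀ (t : ℂˣ) v w, (scalarAction n).smul t v.1 = w.1 → φ w = (t : ℂ) ^ q * φ v}
  zero_mem' := by simp
  add_mem' := by
    intro φ ψ hφ hψ t v w h
    simp [hφ t v w h, hψ t v w h, mul_add]
  smul_mem' := by
    intro c φ hφ t v w h
    simp [hφ t v w h, mul_left_comm]

/-- The regular sections of `𝒪(q)` near `x`: those which give a regular function on the cone. -/
def SerreRegAt (q : ℤ) (s : ∀ x : ℙ ℂ (Fin (n + 1) → ℂ), serreFiber q x)
    (x : ℙ ℂ (Fin (n + 1) → ℂ)) : Prop :=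
  ∀ v, eta v = x → RegularAt (fun w => (s (eta w)).1 ⟨w, rfl⟩) v

/-- The section `x_i ^ q` of `𝒪(q)`, where `x_i ≠ 0`. -/
def serreFrame (q : ℤ) (i : Fin (n + 1)) (x : ℙ ℂ (Fin (n + 1) → ℂ)) : serreFiber q x :=
  ⟨fun v => v.1.val i ^ q, fun t v w h => by simp [← h, mul_zpow]⟩

/-- The coefficient of an element of the fibre with respect to `x_i ^ q`. -/
def serreCoeff (q : ℤ) (i : Fin (n + 1)) {x : ℙ ℂ (Fin (n + 1) → ℂ)} (φ : serreFiber q x) : ℂ :=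
  φ.1 ⟨lift x, eta_lift x⟩ / (lift x).val i ^ q

lemma serreCoeff_eq (q : ℤ) (i : Fin (n + 1)) {x : ℙ ℂ (Fin (n + 1) → ℂ)} (φ : serreFiber q x)
    (v : PuncturedSpace n) (hv : eta v = x) : serreCoeff q i φ = φ.1 ⟨v, hv⟩ / v.val i ^ q := by
  obtain ⟨t, ht⟩ := eta_eq_iff.1 (hv.trans (eta_lift x).symm)
  rw [serreCoeff, φ.2 t ⟨v, hv⟩ _ ht, ← ht, scalarAction_val, mul_zpow,
    mul_div_mul_left _ _ (zpow_ne_zero _ t.ne_zero)]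

lemma serreCoeff_smul (q : ℤ) (i : Fin (n + 1)) {x : ℙ ℂ (Fin (n + 1) → ℂ)} (φ : serreFiber q x)
    (v : PuncturedSpace n) (hv : eta v = x) (hi : v.val i ≠ 0) :
    φ = serreCoeff q i φ • serreFrame q i x := by
  ext ⟨w, hw⟩
  have hwi : w.val i ≠ 0 := by
    obtain ⟨t, rfl⟩ := eta_eq_iff.1 (hv.trans hw.symm)
    simp [hi]
  rw [serreCoeff_eq q i φ w hw]
  exact (div_mul_cancel₀ _ (zpow_ne_zero _ hwi)).symm

lemma isFrameAt_serreFrame (q : ℤ) (i : Fin (n + 1)) (v : PuncturedSpace n) (hi : v.val i ≠ 0) :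
    IsFrameAt (SerreRegAt q) (fun _ : Unit => serreFrame q i) (eta v) := by
  have hev : ∀ u : PuncturedSpace n, eta u = eta v → u.val i ≠ 0 := by
    intro u hu
    obtain ⟨t, rfl⟩ := eta_eq_iff.1 hu.symm
    simp [hi]
  have hnear : ∀ u : PuncturedSpace n, u.val i ≠ 0 → ∀ᶠ w in 𝓝 u, w.val i ≠ 0 :=
    fun u h => eventually_ne_zero (regularAt_coord i u) h
  refine ⟨?_, fun s => ⟨fun hs => ⟨fun _ x => serreCoeff q i (s x), fun _ => ?_, ?_⟩, ?_⟩⟩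
  · have hne : serreFrame q i (eta v) ≠ 0 := by
      intro h
      have := congrArg (fun φ : serreFiber q (eta v) => φ.1 ⟨v, rfl⟩) h
      exact zpow_ne_zero q hi this
    refine ⟨Module.Basis.mk (v := fun _ : Unit => serreFrame q i (eta v))
      (LinearIndependent.of_subsingleton () hne) ?_, fun _ => Module.Basis.mk_apply _ _ _⟩
    rintro φ -
    rw [serreCoeff_smul q i φ v rfl hi]
    exact Submodule.smul_mem _ _ (Submodule.subset_span ⟨(), rfl⟩)
  · rw [regularAt_eta]
    refine regularAt_congr (regularAt_mul (hs v rfl)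
      (regularAt_inv (regularAt_zpow (regularAt_coord i v) hi q) (zpow_ne_zero _ hi)))
      (.of_forall fun w => ?_)
    exact (serreCoeff_eq q i (s (eta w)) w rfl).trans (div_eq_mul_inv _ _)
  · rw [nhds_eta, eventually_map]
    filter_upwards [hnear v hi] with w hw
    simpa using serreCoeff_smul q i (s (eta w)) w rfl hw
  · rintro ⟨c, hc, hs⟩ u hu
    have hu' := hev u hu
    rw [← hu, nhds_eta, eventually_map] at hs
    refine regularAt_congr (regularAt_mul (hc () u hu)
      (regularAt_zpow (regularAt_coord i u) hu' q)) ?_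
    filter_upwards [hs] with w hw
    rw [hw]
    simp [serreFrame]

/-- The line bundle `𝒪(q)` on `ℙ(V)`. -/
def serreTwist (n : ℕ) (q : ℤ) : VectorBundle (ℙ ℂ (Fin (n + 1) → ℂ)) where
  Fiber x := serreFiber q x
  RegAt := SerreRegAt q
  exists_frame x := by
    obtain ⟨v, rfl⟩ := eta_surjective x
    obtain ⟨i, hi⟩ : ∃ i, v.val i ≠ 0 := by
      by_contra! h
      exact v.ne_zero (funext h)
    refine ⟨Unit, inferInstance, fun _ => serreFrame q i, ?_⟩
    rw [nhds_eta, eventually_map]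
    filter_upwards [eventually_ne_zero (regularAt_coord i v) hi] with w hw
    exact isFrameAt_serreFrame q i w hw

lemma eta_weightAction_inv (d : Fin (n + 1) → ℕ) {t : ℂˣ} {x y : ℙ ℂ (Fin (n + 1) → ℂ)}
    (h : (projWeightAction d).smul t x = y) {w : PuncturedSpace n} (hw : eta w = y) :
    eta ((weightAction d).smul t⁻¹ w) = x := by
  rw [eta_weightAction, hw, ← (AlgAction.smul_eq_iff _).1 h]

/-- The line bundle `𝒪(k)` with its natural linearization, above the action on `ℙ(V)` induced by the
action `σ = weightAction d` on `V`: an element `t` takes a homogeneous function `φ` on a line to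
the function `w ↦ φ (σ(t)⁻¹ w)` on the image of that line. -/
def linearizedSerreTwist (d : Fin (n + 1) → ℕ) (k : ℤ) :
    LinearizedBundle (projWeightAction d) where
  toVectorBundle := serreTwist n k
  act t x y h :=
    { toFun := fun φ => ⟨fun w => φ.1 ⟨(weightAction d).smul t⁻¹ w.1,
          eta_weightAction_inv d h w.2⟩, by
        intro s v w hvw
        refine φ.2 s _ _ ?_
        ext i
        simp [← hvw, mul_left_comm]⟩
      map_add' := fun _ _ => rfl
      map_smul' := fun _ _ => rfl }
  act_one h φ := by
    refine Subtype.ext (funext fun w => congrArg φ.1 (Subtype.ext ?_))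
    simp only [inv_one]
    exact AlgAction.one_smul' _ _
  act_mul t t' x y z h h' h'' φ := by
    refine Subtype.ext (funext fun w => congrArg φ.1 (Subtype.ext ?_))
    simp only [mul_inv_rev]
    exact AlgAction.mul_smul' _ _ _ _
  act_regular s x t hs := by
    obtain ⟨v, rfl⟩ := eta_surjective x
    obtain ⟨i, hi⟩ : ∃ i, v.val i ≠ 0 := by
      by_contra! h
      exact v.ne_zero (funext h)
    obtain ⟨c, hc, hsc⟩ := ((isFrameAt_serreFrame k i v hi).2 s).1 hs
    refine ⟨Unit, inferInstance, fun _ z => (z.fst : ℂ) ^ (-(d i * k)) * c () z.snd,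
      fun _ => serreFrame k i, fun _ => regularAt_mul (regularAt_fst_zpow _ _)
        ((regularMapAt_snd _).2 _ (hc ())), fun _ => ?_, ?_⟩
    · have hv : ((weightAction d).smul t v).val i ≠ 0 := by simp [hi]
      have := isFrameAt_serreFrame k i _ hv
      rw [eta_weightAction] at this
      exact VectorBundle.frame_regAt (E := serreTwist n k) this ()
    · filter_upwards [(regularMapAt_snd (CstarProd.mk t (eta v))).1.eventually hsc] with z hz
      refine Subtype.ext (funext fun w => ?_)
      have h1 : s z.snd = c () z.snd • serreFrame k i z.snd :=
        hz.trans (Fintype.sum_unique _)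
      have h2 := congrArg (fun φ : serreFiber k z.snd => φ.1 ⟨(weightAction d).smul z.fst⁻¹ w.1,
        eta_weightAction_inv d rfl w.2⟩) h1
      have h3 : c () z.snd * ((z.fst⁻¹ : ℂˣ) ^ d i * w.1.val i : ℂ) ^ k =
          (z.fst : ℂ) ^ (-(d i * k)) * c () z.snd * w.1.val i ^ k := by
        rw [mul_zpow, Units.val_inv_eq_inv_val, inv_pow, inv_zpow', zpow_neg, zpow_neg, zpow_mul,
          zpow_natCast]
        ring
      refine (h2.trans h3).trans ?_
      rw [Fintype.sum_unique]
      rfl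

/-! ### The generalized inverse image -/

/-- The functor `η^*` from vector bundles on `ℙ(V)` to vector bundles on `V ∖ {0}` with an action
above the scalar multiplication. -/
def etaPullback (n : ℕ) :
    VectorBundle (ℙ ℂ (Fin (n + 1) → ℂ)) ⥤ LinearizedBundle (scalarAction n) :=
  LinearizedBundle.trivial _ ⋙ LinearizedBundle.pullback eta regularMap_eta eta_smul

instance : (etaPullback n).Faithful where
  map_injective {E F f g} h := by
    refine VectorBundle.hom_ext fun x => ?_
    obtain ⟨v, rfl⟩ := eta_surjective x
    intro u
    exact congrArg (fun k => VectorBundle.Hom.map (LinearizedBundle.Hom.hom k) v u) h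

lemma VectorBundle.regAt_of_pullbackRegAt_eta {F : VectorBundle (ℙ ℂ (Fin (n + 1) → ℂ))}
    {s : ∀ x, F.Fiber x} {v : PuncturedSpace n}
    (h : PullbackRegAt eta F (fun w => s (eta w)) v) : F.RegAt s (eta v) := by
  obtain ⟨κ, _, c, e, hc, he, hs⟩ := h
  obtain ⟨τ, u, h0, hτ⟩ := exists_local_section v
  have hτv := hτ.self_of_nhds.2.1
  rw [← h0] at hs
  refine regAt_congr (s := fun x => ∑ k, c k (τ x) • e k x)
    (regAt_sum (fun k => hτv.2 _ (by rw [h0]; exact hc k)) he) ?_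
  filter_upwards [hτ, hτv.1.eventually hs] with x hx hsx
  rwa [hx.1] at hsx

lemma VectorBundle.pullbackRegAt_comp {X Y : Type} [FunctionSpace X] [FunctionSpace Y] (φ : X → Y)
    {E : VectorBundle Y} {s : ∀ y, E.Fiber y} {x : X} (h : E.RegAt s (φ x)) :
    PullbackRegAt φ E (fun z => s (φ z)) x :=
  ⟨Unit, inferInstance, fun _ _ => 1, fun _ => s, fun _ => regularAt_const _ _, fun _ => h,
    .of_forall fun z => by simp⟩

instance : (etaPullback n).Full where
  map_surjective {E F} ψ := by
    have hψ : ∀ (t : ℂˣ) {v w : PuncturedSpace n} (h : (scalarAction n).smul t v = w)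
        (p : eta v = eta w) (z : E.Fiber (eta v)),
        ψ.hom.map w (LinearEquiv.cast (R := ℂ) (M := E.Fiber) p z) =
          LinearEquiv.cast (R := ℂ) (M := F.Fiber) p (ψ.hom.map v z) :=
      fun t v w h p z => ψ.equivariant t h z
    have hcast : ∀ {x y : ℙ ℂ (Fin (n + 1) → ℂ)} (p : x = y) (A : E.Fiber x →ₗ[ℂ] F.Fiber x)
        (B : E.Fiber y →ₗ[ℂ] F.Fiber y), (∀ z, B (LinearEquiv.cast (R := ℂ) (M := E.Fiber) p z) =
          LinearEquiv.cast (R := ℂ) (M := F.Fiber) p (A z)) → p ▸ A = B := by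
      rintro x _ rfl A B h
      exact LinearMap.ext fun z => (h z).symm
    let φ : ∀ x, E.Fiber x →ₗ[ℂ] F.Fiber x := fun x => (eta_lift x) ▸ (ψ.hom.map (lift x) :
      E.Fiber (eta (lift x)) →ₗ[ℂ] F.Fiber (eta (lift x)))
    have hφ : ∀ v, φ (eta v) = ψ.hom.map v := by
      intro v
      obtain ⟨t, ht⟩ := eta_eq_iff.1 (eta_lift (eta v))
      exact hcast _ _ _ (hψ t ht (eta_lift (eta v)))
    refine ⟨⟨φ, fun s x hs => ?_⟩, ?_⟩
    · obtain ⟨v, rfl⟩ := eta_surjective x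
      have := ψ.hom.regular _ v (VectorBundle.pullbackRegAt_comp eta hs)
      refine VectorBundle.regAt_of_pullbackRegAt_eta ?_
      simp only [hφ]
      exact this
    · refine LinearizedBundle.hom_ext (VectorBundle.hom_ext fun v z => ?_)
      exact congrArg (fun A : E.Fiber (eta v) →ₗ[ℂ] F.Fiber (eta v) => A z) (hφ v)

section Descent

variable (G : LinearizedBundle (scalarAction n))

lemma scalarAction_free {t t' : ℂˣ} {v : PuncturedSpace n}
    (h : (scalarAction n).smul t v = (scalarAction n).smul t' v) : t = t' := by
  obtain ⟨i, hi⟩ : ∃ i, v.val i ≠ 0 := by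
    by_contra! h
    exact v.ne_zero (funext h)
  have := congrArg (fun w => PuncturedSpace.val w i) h
  simp only [scalarAction_val] at this
  exact Units.ext (mul_right_cancel₀ hi this)

/-- The action identifies the fibres at the points of a line. -/
def moveMap {v w : PuncturedSpace n} (h : eta v = eta w) : G.Fiber v →ₗ[ℂ] G.Fiber w :=
  G.act (eta_eq_iff.1 h).choose (eta_eq_iff.1 h).choose_spec

lemma act_eq_moveMap {t : ℂˣ} {v w : PuncturedSpace n} (ht : (scalarAction n).smul t v = w)
    (h : eta v = eta w) (z : G.Fiber v) : G.act t ht z = moveMap G h z := by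
  have := scalarAction_free (ht.trans (eta_eq_iff.1 h).choose_spec.symm)
  subst this
  rfl

lemma moveMap_self {v : PuncturedSpace n} (h : eta v = eta v) (z : G.Fiber v) :
    moveMap G h z = z := by
  rw [← act_eq_moveMap G (AlgAction.one_smul' _ v) h, G.act_one]

lemma moveMap_moveMap {v w x : PuncturedSpace n} (h : eta v = eta w) (h' : eta w = eta x)
    (z : G.Fiber v) : moveMap G h' (moveMap G h z) = moveMap G (h.trans h') z := by
  obtain ⟨t, ht⟩ := eta_eq_iff.1 h
  obtain ⟨t', ht'⟩ := eta_eq_iff.1 h'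
  have ht'' : (scalarAction n).smul (t' * t) v = x := by rw [AlgAction.mul_smul', ht, ht']
  rw [← act_eq_moveMap G ht h, ← act_eq_moveMap G ht' h', ← act_eq_moveMap G ht'' (h.trans h'),
    G.act_mul t' t ht ht' ht'']

/-- `moveMap` as an isomorphism. -/
def moveEquiv {v w : PuncturedSpace n} (h : eta v = eta w) : G.Fiber v ≃ₗ[ℂ] G.Fiber w :=
  LinearEquiv.ofLinearMap (moveMap G h) (moveMap G h.symm)
    (LinearMap.ext fun z => by simp [moveMap_moveMap, moveMap_self])
    (LinearMap.ext fun z => by simp [moveMap_moveMap, moveMap_self])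

/-- The equivariant section over the cone defined by a family of vectors at the points
`lift x`. -/
def spread (s : ∀ x, G.Fiber (lift x)) (w : PuncturedSpace n) : G.Fiber w :=
  moveMap G (eta_lift (eta w)) (s (eta w))

open Classical in
/-- Restriction of a section to the local section `τ`. -/
def slice (τ : ℙ ℂ (Fin (n + 1) → ℂ) → PuncturedSpace n) (f : ∀ v, G.Fiber v)
    (x : ℙ ℂ (Fin (n + 1) → ℂ)) : G.Fiber (lift x) :=
  if h : eta (τ x) = eta (lift x) then moveMap G h (f (τ x)) else 0

lemma slice_eq {τ : ℙ ℂ (Fin (n + 1) → ℂ) → PuncturedSpace n} (f : ∀ v, G.Fiber v)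
    {x : ℙ ℂ (Fin (n + 1) → ℂ)} (h : eta (τ x) = eta (lift x)) :
    slice G τ f x = moveMap G h (f (τ x)) := dif_pos h

lemma moveMap_spread (s : ∀ x, G.Fiber (lift x)) {v : PuncturedSpace n}
    {x : ℙ ℂ (Fin (n + 1) → ℂ)} (hv : eta v = x) (h : eta v = eta (lift x)) :
    moveMap G h (spread G s v) = s x := by
  subst hv
  rw [spread, moveMap_moveMap, moveMap_self]

lemma spread_slice {τ : ℙ ℂ (Fin (n + 1) → ℂ) → PuncturedSpace n} (f : ∀ v, G.Fiber v)
    {w : PuncturedSpace n} (h : eta (τ (eta w)) = eta w) :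
    spread G (slice G τ f) w = moveMap G h (f (τ (eta w))) := by
  rw [spread, slice_eq G f (h.trans (eta_lift _).symm), moveMap_moveMap]

lemma regAt_spread_slice {τ : ℙ ℂ (Fin (n + 1) → ℂ) → PuncturedSpace n}
    {u : PuncturedSpace n → ℂˣ} {w₀ : PuncturedSpace n}
    (hτ : ∀ᶠ x in 𝓝 (eta w₀), IsSectionAt τ u x) {f : ∀ v, G.Fiber v}
    (hf : G.RegAt f (τ (eta w₀))) : G.RegAt (spread G (slice G τ f)) w₀ := by
  obtain ⟨κ, _, d, e, hd, he, h⟩ := G.act_regular f _ (u w₀) hf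
  obtain ⟨h1, h2, h3⟩ := hτ.self_of_nhds
  obtain ⟨h4, h5⟩ := h3 w₀ rfl
  have hΨ : RegularMapAt (fun w => CstarProd.mk (u w) (τ (eta w))) w₀ :=
    regularMapAt_cstarProd h5 (h2.comp (regularMap_eta w₀))
  refine VectorBundle.regAt_congr (VectorBundle.regAt_sum (fun k => hΨ.2 _ (hd k))
    (s := fun k => e k) (fun k => ?_)) ?_
  · have := he k
    simp only [h4] at this
    exact this
  · rw [nhds_eta, eventually_map] at hτ
    filter_upwards [hτ, hΨ.1.eventually h] with w hw hw'
    have key : ∀ y (p : (scalarAction n).smul (u w) (τ (eta w)) = y),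
        G.act (u w) p (f (τ (eta w))) = ∑ k, d k ⟨u w, τ (eta w)⟩ • e k y := by
      rintro y rfl
      exact hw'
    rw [spread_slice G f hw.1, ← act_eq_moveMap G (hw.2.2 w rfl).1]
    exact key w _

/-- The bundle on `ℙ(V)` defined by a bundle on `V ∖ {0}` with an action above the scalar
multiplication; its regular sections are the equivariant regular sections over the cone. -/
def descend : VectorBundle (ℙ ℂ (Fin (n + 1) → ℂ)) where
  Fiber x := G.Fiber (lift x)
  RegAt s x := ∀ v, eta v = x → G.RegAt (spread G s) v
  exists_frame x₀ := by
    obtain ⟨v₀, rfl⟩ := eta_surjective x₀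
    obtain ⟨ι, _, e, he⟩ := G.exists_frame v₀
    obtain ⟨τ, u, h0, hτ⟩ := exists_local_section v₀
    refine ⟨ι, inferInstance, fun i => slice G τ (e i), ?_⟩
    have he' := he
    rw [← h0] at he'
    filter_upwards [eventually_eventually_nhds.2 hτ,
      hτ.self_of_nhds.2.1.1.eventually he'] with x hx hex
    obtain ⟨h1, h2, h3⟩ := hx.self_of_nhds
    have hx1 : eta (τ x) = eta (lift x) := h1.trans (eta_lift x).symm
    refine ⟨?_, fun s => ⟨fun hs => ?_, ?_⟩⟩
    · obtain ⟨b, hb⟩ := hex.1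
      exact ⟨b.map (moveEquiv G hx1), fun i => by
        rw [Module.Basis.map_apply, hb]; exact (slice_eq G (e i) hx1).symm⟩
    · obtain ⟨c, hc, hsc⟩ := (hex.2 _).1 (hs (τ x) h1)
      refine ⟨fun i y => c i (τ y), fun i => h2.2 _ (hc i), ?_⟩
      filter_upwards [hx, h2.1.eventually hsc] with y hy hsy
      have hy1 : eta (τ y) = eta (lift y) := hy.1.trans (eta_lift y).symm
      rw [← moveMap_spread G s hy.1 hy1, hsy, map_sum]
      exact Finset.sum_congr rfl fun i _ => by rw [map_smul, slice_eq G _ hy1]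
    · rintro ⟨c, hc, hs⟩ w rfl
      refine VectorBundle.regAt_congr (VectorBundle.regAt_sum
        (c := fun i w => c i (eta w)) (s := fun i => spread G (slice G τ (e i)))
        (fun i => regularAt_eta.1 (hc i))
        (fun i => regAt_spread_slice G hx (VectorBundle.frame_regAt hex i))) ?_
      rw [nhds_eta, eventually_map] at hs
      filter_upwards [hs] with w' hw'
      rw [spread, hw', map_sum]
      exact Finset.sum_congr rfl fun i _ => by rw [map_smul]; rfl

lemma moveMap_cast {x y : ℙ ℂ (Fin (n + 1) → ℂ)} (p : x = y) {w : PuncturedSpace n}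
    (hx : eta (lift x) = eta w) (hy : eta (lift y) = eta w) (z : G.Fiber (lift x)) :
    moveMap G hy (LinearEquiv.cast (R := ℂ) (M := (descend G).Fiber) p z) = moveMap G hx z := by
  subst p
  rfl

lemma cast_moveMap {x y : ℙ ℂ (Fin (n + 1) → ℂ)} (p : x = y) {w : PuncturedSpace n}
    (hx : eta w = eta (lift x)) (hy : eta w = eta (lift y)) (z : G.Fiber w) :
    LinearEquiv.cast (R := ℂ) (M := (descend G).Fiber) p (moveMap G hx z) = moveMap G hy z := by
  subst p
  rfl

/-- `η^*` of the descended bundle is the bundle one started with. -/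
def etaPullbackDescendIso : (etaPullback n).obj (descend G) ≅ G where
  hom :=
    { hom :=
        { map := fun w => moveMap G (eta_lift (eta w))
          regular := by
            rintro s w ⟨κ, _, c, e, hc, he, hs⟩
            refine VectorBundle.regAt_congr (VectorBundle.regAt_sum hc
              (fun k => he k w rfl)) ?_
            filter_upwards [hs] with w' hw'
            have h1 : moveMap G (eta_lift (eta w')) (s w') = moveMap G (eta_lift (eta w'))
              (∑ k, c k w' • (e k (eta w') : G.Fiber (lift (eta w')))) := congrArg _ hw'
            refine h1.trans ((map_sum (moveMap G (eta_lift (eta w'))) _ _).trans ?_)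
            exact Finset.sum_congr rfl fun k _ => map_smul (moveMap G (eta_lift (eta w'))) _ _ }
      equivariant := fun t v w h z => by
        have p : eta v = eta w := eta_eq_iff.2 ⟨t, h⟩
        refine (moveMap_cast G p ((eta_lift _).trans p) (eta_lift _) z).trans ?_
        exact ((act_eq_moveMap G h p (moveMap G (eta_lift (eta v)) z)).trans
          (moveMap_moveMap G (eta_lift (eta v)) p z)).symm }
  inv :=
    { hom :=
        { map := fun w => moveMap G (eta_lift (eta w)).symm
          regular := by
            intro s v hs
            obtain ⟨τ, u, h0, hτ⟩ := exists_local_section v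
            obtain ⟨h1, h2, h3⟩ := hτ.self_of_nhds
            obtain ⟨h4, h5⟩ := h3 v rfl
            obtain ⟨κ, _, d, f, hd, hf, h⟩ := G.act_regular s v (u v)⁻¹ hs
            have h6 : (scalarAction n).smul (u v)⁻¹ v = τ (eta v) :=
              ((AlgAction.smul_eq_iff _).1 h4).symm
            have hΨ : RegularMapAt (fun w => CstarProd.mk (u w)⁻¹ w) v := by
              refine regularMapAt_cstarProd ?_ (regularMapAt_id v)
              simpa only [Units.val_inv_eq_inv_val] using regularAt_inv h5 (u v).ne_zero
            refine ⟨κ, inferInstance, fun k w => d k ⟨(u w)⁻¹, w⟩,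
              fun k => slice G τ (f k), fun k => hΨ.2 _ (hd k), fun k w hw => ?_, ?_⟩
            · rw [← hw] at hτ
              refine regAt_spread_slice G hτ ?_
              have := hf k
              simp only [h6] at this
              rw [hw]
              exact this
            · rw [nhds_eta, eventually_map] at hτ
              filter_upwards [hτ, hΨ.1.eventually h] with w hw hw'
              have h7 : (scalarAction n).smul (u w)⁻¹ w = τ (eta w) :=
                ((AlgAction.smul_eq_iff _).1 (hw.2.2 w rfl).1).symm
              have key : ∀ y (p : (scalarAction n).smul (u w)⁻¹ w = y),
                  G.act (u w)⁻¹ p (s w) = ∑ k, d k ⟨(u w)⁻¹, w⟩ • f k y := by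
                rintro y rfl
                exact hw'
              have h8 : eta (τ (eta w)) = eta (lift (eta w)) := hw.1.trans (eta_lift _).symm
              have h9 := congrArg (moveMap G h8) (key _ h7)
              rw [act_eq_moveMap G h7 hw.1.symm, moveMap_moveMap, map_sum] at h9
              refine h9.trans (Finset.sum_congr rfl fun k _ => ?_)
              exact (map_smul _ _ _).trans (congrArg _ (slice_eq G (f k) h8).symm) }
      equivariant := fun t v w h z => by
        have p : eta v = eta w := eta_eq_iff.2 ⟨t, h⟩
        refine Eq.trans ?_ (cast_moveMap G p (eta_lift _).symm (p.trans (eta_lift _).symm) z).symm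
        exact (congrArg (moveMap G (eta_lift (eta w)).symm) (act_eq_moveMap G h p z)).trans
          (moveMap_moveMap G p (eta_lift (eta w)).symm z) }
  hom_inv_id := by
    refine LinearizedBundle.hom_ext (VectorBundle.hom_ext fun v z => ?_)
    exact (moveMap_moveMap G (eta_lift (eta v)) (eta_lift (eta v)).symm z).trans
      (moveMap_self G rfl z)
  inv_hom_id := by
    refine LinearizedBundle.hom_ext (VectorBundle.hom_ext fun v z => ?_)
    exact (moveMap_moveMap G (eta_lift (eta v)).symm (eta_lift (eta v)) z).trans
      (moveMap_self G rfl z)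

instance : (etaPullback n).EssSurj := ⟨fun G => ⟨descend G, ⟨etaPullbackDescendIso G⟩⟩⟩

instance : (etaPullback n).IsEquivalence where

end Descent
/-! ### The generalized inverse image -/

/-- The map `ω = (g_0, …, g_n) : V_1 ∖ {0} → V_2 ∖ {0}`. -/
def omega (g : Fin (n + 1) → MvPolynomial (Fin (n + 1)) ℂ)
    (hg : ∀ v : Fin (n + 1) → ℂ, v ≠ 0 → ∃ i, MvPolynomial.eval v (g i) ≠ 0)
    (v : PuncturedSpace n) : PuncturedSpace n :=
  ⟨fun i => MvPolynomial.eval v.val (g i), fun h => by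
    obtain ⟨i, hi⟩ := hg v.val v.ne_zero
    exact hi (congrFun h i)⟩

lemma regularAt_eval (p : MvPolynomial (Fin (n + 1)) ℂ) (v : PuncturedSpace n) :
    RegularAt (fun w : PuncturedSpace n => MvPolynomial.eval w.val p) v := by
  induction p using MvPolynomial.induction_on with
  | C c => simpa using regularAt_const c v
  | add p q hp hq => simpa using regularAt_add hp hq
  | mul_X p i hp => simpa using regularAt_mul hp (regularAt_coord i v)

lemma regularMap_omega (g : Fin (n + 1) → MvPolynomial (Fin (n + 1)) ℂ)
    (hg : ∀ v : Fin (n + 1) → ℂ, v ≠ 0 → ∃ i, MvPolynomial.eval v (g i) ≠ 0) :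
    RegularMap (omega g hg) := fun v => regularMapAt_punctured fun i => regularAt_eval (g i) v

lemma omega_smul {d : Fin (n + 1) → ℕ} (g : Fin (n + 1) → MvPolynomial (Fin (n + 1)) ℂ)
    (hd : ∀ i, (g i).IsHomogeneous (d i))
    (hg : ∀ v : Fin (n + 1) → ℂ, v ≠ 0 → ∃ i, MvPolynomial.eval v (g i) ≠ 0)
    (t : ℂˣ) (v : PuncturedSpace n) :
    omega g hg ((scalarAction n).smul t v) = (weightAction d).smul t (omega g hg v) := by
  ext i
  have h : ((scalarAction n).smul t v).val = (t : ℂ) • v.val := by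
    ext j
    simp
  simp only [omega, h, weightAction_val]
  rw [MvPolynomial.eval_eq', MvPolynomial.eval_eq', Finset.mul_sum]
  refine Finset.sum_congr rfl fun m hm => ?_
  have hm' : ∑ j, m j = d i := by
    rw [← Finsupp.degree_eq_sum, ← hd i (MvPolynomial.mem_support_iff.1 hm),
      Finsupp.degree_eq_weight_one]
    rfl
  simp only [Pi.smul_apply, smul_eq_mul, mul_pow, Finset.prod_mul_distrib,
    Finset.prod_pow_eq_pow_sum, hm']
  ring

/-- The functor `ω^* η_2^*` from vector bundles on `ℙ(V_2)` with an action above the one induced by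
`σ = weightAction d` to vector bundles on `V_1 ∖ {0}` with an action above the scalar
multiplication. -/
def omegaEtaPullback {d : Fin (n + 1) → ℕ} (g : Fin (n + 1) → MvPolynomial (Fin (n + 1)) ℂ)
    (hd : ∀ i, (g i).IsHomogeneous (d i))
    (hg : ∀ v : Fin (n + 1) → ℂ, v ≠ 0 → ∃ i, MvPolynomial.eval v (g i) ≠ 0) :
    LinearizedBundle (projWeightAction d) ⥤ LinearizedBundle (scalarAction n) :=
  LinearizedBundle.pullback eta regularMap_eta (eta_weightAction d) ⋙
    LinearizedBundle.pullback (omega g hg) (regularMap_omega g hg) (omega_smul g hd hg)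

/-- The generalized inverse image (Horrocks transformation): the functor, unique up to isomorphism,
whose composition with the equivalence of categories `η_1^*` is `ω^* η_2^*`. -/
def Iminvg {d : Fin (n + 1) → ℕ} (g : Fin (n + 1) → MvPolynomial (Fin (n + 1)) ℂ)
    (hd : ∀ i, (g i).IsHomogeneous (d i))
    (hg : ∀ v : Fin (n + 1) → ℂ, v ≠ 0 → ∃ i, MvPolynomial.eval v (g i) ≠ 0) :
    LinearizedBundle (projWeightAction d) ⥤ VectorBundle (ℙ ℂ (Fin (n + 1) → ℂ)) :=
  omegaEtaPullback g hd hg ⋙ (etaPullback n).inv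

/-- The defining property of the generalized inverse image: `η_1^* (Iminvg F) ≅ ω^* η_2^* F` as
bundles with an action, naturally in `F`. -/
def iminvgCompEtaPullback {d : Fin (n + 1) → ℕ}
    (g : Fin (n + 1) → MvPolynomial (Fin (n + 1)) ℂ)
    (hd : ∀ i, (g i).IsHomogeneous (d i))
    (hg : ∀ v : Fin (n + 1) → ℂ, v ≠ 0 → ∃ i, MvPolynomial.eval v (g i) ≠ 0) :
    Iminvg g hd hg ⋙ etaPullback n ≅ omegaEtaPullback g hd hg :=
  Functor.associator _ _ _ ≪≫
    Functor.isoWhiskerLeft (omegaEtaPullback g hd hg) (etaPullback n).asEquivalence.counitIso ≪≫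
    Functor.rightUnitor _

end

end Horrocks

namespace Horrocks

open FunctionSpace

noncomputable section

variable {n : ℕ}

/-! Since `etaPullback n` is fully faithful, both isomorphisms may be constructed after applying
`η_1^*`, where `Iminvg` turns into `ω^* η_2^*`. Everything then takes place over `V_1 ∖ {0}`.

The point is that `η^* 𝒪(q)` is trivial on the cone. An element of its fibre at `v` is a function on
the line through `v`, homogeneous of degree `q`; evaluation at `v` (`serreEval`) identifies the
fibre with `ℂ`, and the elements of value `1` (`serreUnit`) form a nowhere vanishing regular
section. Two computations of actions carry the proof. The action on `η^* 𝒪(q)` above the scalar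
action moves the unit at `v` to `t ^ q` times the unit at `t v` (`cast_serreUnit`), so `η^* 𝒪(q)` is
the trivial line bundle with character `t ^ q`. The natural linearization of `𝒪(k)` transports
functions along `σ`, hence preserves values and fixes the unit section (`act_serreUnit`): `η_2^*
𝒪(k)` is equivariantly trivial, whatever `k` is.

For the line bundles, multiplying the action by `t ^ q` therefore makes `ω^* η_2^* 𝒪(k)` the trivial
line bundle with character `t ^ q`, which is `η_1^* 𝒪(q)` (`omegaEtaPullbackSerreIso`). For general
`E`, the map `m ↦ m ⊗ serreUnit q v` identifies `(η^* F)^{(q)}` with `η^* (F ⊗ 𝒪(q))`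
(`etaPullbackTwistIso`), and a change of the action by a character commutes with equivariant pull
back (`LinearizedBundle.twistCompPullback`); combining the two gives `twistCompIminvg`. -/

lemma PuncturedSpace.exists_coord_ne_zero (v : PuncturedSpace n) : ∃ i, v.val i ≠ 0 := by
  by_contra! h
  exact v.ne_zero (funext h)

/-! ### The trivialization of `η^* 𝒪(q)` by the section of value one -/

/-- An element of the fibre of `𝒪(q)` at the line through `v` is determined by its value at `v`. -/
lemma serreFiber_ext {q : ℤ} {v : PuncturedSpace n} {φ ψ : serreFiber q (eta v)}
    (h : φ.1 ⟨v, rfl⟩ = ψ.1 ⟨v, rfl⟩) : φ = ψ := by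
  refine Subtype.ext (funext fun ⟨w, hw⟩ => ?_)
  obtain ⟨t, ht⟩ := eta_eq_iff.1 hw.symm
  rw [φ.2 t ⟨v, rfl⟩ ⟨w, hw⟩ ht, ψ.2 t ⟨v, rfl⟩ ⟨w, hw⟩ ht, h]

/-- Evaluation at `v`, on the fibre of `𝒪(q)` at the line through `v`. -/
def serreEval (q : ℤ) (v : PuncturedSpace n) : serreFiber q (eta v) →ₗ[ℂ] ℂ where
  toFun φ := φ.1 ⟨v, rfl⟩
  map_add' _ _ := rfl
  map_smul' _ _ := rfl

/-- The element of the fibre of `𝒪(q)` at the line through `v` that takes the value `1` at `v`. -/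
def serreUnit (q : ℤ) (v : PuncturedSpace n) : serreFiber q (eta v) :=
  (v.val v.exists_coord_ne_zero.choose ^ q)⁻¹ •
    serreFrame q v.exists_coord_ne_zero.choose (eta v)

@[simp] lemma serreEval_serreUnit (q : ℤ) (v : PuncturedSpace n) :
    serreEval q v (serreUnit q v) = 1 :=
  inv_mul_cancel₀ (zpow_ne_zero _ v.exists_coord_ne_zero.choose_spec)

/-- Both sides take the same value at `v`, which determines a homogeneous function on the line; so
the unit spans the fibre. -/
lemma serreEval_smul_serreUnit {q : ℤ} {v : PuncturedSpace n} (φ : serreFiber q (eta v)) :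
    serreEval q v φ • serreUnit q v = φ := by
  refine serreFiber_ext ?_
  change serreEval q v (serreEval q v φ • serreUnit q v) = serreEval q v φ
  simp

/-- The coordinate in the definition of `serreUnit` is chosen separately at each point. Any
nonvanishing coordinate gives the same element, so near a given point a single `i` serves for all
units; this is what makes the unit section regular. -/
lemma serreUnit_eq (q : ℤ) {v : PuncturedSpace n} {i : Fin (n + 1)} (hi : v.val i ≠ 0) :
    serreUnit q v = (v.val i ^ q)⁻¹ • serreFrame q i (eta v) := by
  refine serreFiber_ext ?_
  change serreEval q v (serreUnit q v) = (v.val i ^ q)⁻¹ * v.val i ^ q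
  rw [serreEval_serreUnit, inv_mul_cancel₀ (zpow_ne_zero _ hi)]

/-- The sections `serreUnit` form a regular section of `η^* 𝒪(q)`. -/
lemma pullbackRegAt_serreUnit (q : ℤ) (v : PuncturedSpace n) :
    VectorBundle.PullbackRegAt eta (serreTwist n q) (fun w => serreUnit q w) v := by
  obtain ⟨i, hi⟩ := v.exists_coord_ne_zero
  refine ⟨Unit, inferInstance, fun _ w => (w.val i ^ q)⁻¹, fun _ => serreFrame q i,
    fun _ => regularAt_inv (regularAt_zpow (regularAt_coord i v) hi q) (zpow_ne_zero _ hi),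
    fun _ => VectorBundle.frame_regAt (E := serreTwist n q) (isFrameAt_serreFrame q i v hi) (), ?_⟩
  filter_upwards [eventually_ne_zero (regularAt_coord i v) hi] with w hw
  exact (serreUnit_eq q hw).trans (Fintype.sum_unique
    fun _ : Unit => (w.val i ^ q)⁻¹ • serreFrame q i (eta w)).symm

/-- The values of a regular section of `η^* 𝒪(q)` form a regular function. -/
lemma regularAt_serreEval {q : ℤ} {s : ∀ w : PuncturedSpace n, serreFiber q (eta w)}
    {v : PuncturedSpace n} (h : VectorBundle.PullbackRegAt eta (serreTwist n q) s v) :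
    RegularAt (fun w => serreEval q w (s w)) v := by
  obtain ⟨κ, _, c, e, hc, he, hs⟩ := h
  -- `he k v rfl` applies because a section of `𝒪(q)` is regular, by definition, when its values on
  -- the cone form a regular function.
  refine regularAt_congr (regularAt_sum Finset.univ fun k _ => regularAt_mul (hc k) (he k v rfl)) ?_
  filter_upwards [hs] with w hw
  refine (congrArg (serreEval q w) hw).trans ((map_sum (serreEval q w) _ _).trans ?_)
  exact Finset.sum_congr rfl fun k _ => map_smul (serreEval q w) _ _

/-- The values of a regular section of `φ^* η^* 𝒪(q)` form a regular function. -/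
lemma regularAt_serreEval_comp {X : Type} [FunctionSpace X] {φ : X → PuncturedSpace n}
    (hφ : RegularMap φ) {q : ℤ} {s : ∀ x : X, serreFiber q (eta (φ x))} {x : X}
    (h : VectorBundle.PullbackRegAt φ ((serreTwist n q).pullbackObj eta regularMap_eta) s x) :
    RegularAt (fun y => serreEval q (φ y) (s y)) x := by
  obtain ⟨κ, _, c, e, hc, he, hs⟩ := h
  -- The values of the generating sections of `η^* 𝒪(q)` are regular at `φ x`, and `φ` pulls them
  -- back to regular functions at `x`.
  refine regularAt_congr (regularAt_sum Finset.univ fun k _ => regularAt_mul (hc k)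
    ((hφ x).2 _ (regularAt_serreEval (he k)))) ?_
  filter_upwards [hs] with w hw
  refine (congrArg (serreEval q (φ w)) hw).trans ((map_sum (serreEval q (φ w)) _ _).trans ?_)
  exact Finset.sum_congr rfl fun k _ => map_smul (serreEval q (φ w)) _ _

/-- The action on `η^* 𝒪(q)` multiplies the values by `t ^ q`. -/
lemma serreEval_cast {q : ℤ} {t : ℂˣ} {v w : PuncturedSpace n}
    (h : (scalarAction n).smul t v = w) (p : eta v = eta w) (φ : serreFiber q (eta v)) :
    serreEval q w (LinearEquiv.cast (R := ℂ) (M := fun x => serreFiber q x) p φ) =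
      (t : ℂ) ^ q * serreEval q v φ := by
  -- The endpoint `eta w` is replaced by a variable so that the equality of lines can be eliminated;
  -- what remains is the homogeneity of `φ`.
  have key : ∀ x (p : eta v = x) (hw : eta w = x),
      (LinearEquiv.cast (R := ℂ) (M := fun x => serreFiber q x) p φ).1 ⟨w, hw⟩ =
        (t : ℂ) ^ q * serreEval q v φ := by
    rintro x rfl hw
    exact φ.2 t ⟨v, rfl⟩ ⟨w, hw⟩ h
  exact key _ p rfl

/-- A function of degree `q` with value `1` at `v` has value `t ^ q` at `t v`. This is the source of
the character `t ^ q` in both isomorphisms. -/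
lemma cast_serreUnit {q : ℤ} {t : ℂˣ} {v w : PuncturedSpace n}
    (h : (scalarAction n).smul t v = w) (p : eta v = eta w) :
    LinearEquiv.cast (R := ℂ) (M := fun x => serreFiber q x) p (serreUnit q v) =
      (t : ℂ) ^ q • serreUnit q w := by
  refine serreFiber_ext ?_
  refine (serreEval_cast h p _).trans ?_
  change _ = serreEval q w ((t : ℂ) ^ q • serreUnit q w)
  simp

/-! ### Twisting and pulling back -/

/-- Multiplication of the action by a character commutes with pull back. -/
def LinearizedBundle.twistCompPullback {X Y : Type} [FunctionSpace X] [FunctionSpace Y]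
    {a : AlgAction X} {b : AlgAction Y} (φ : X → Y) (hφ : RegularMap φ)
    (hab : ∀ t x, φ (a.smul t x) = b.smul t (φ x)) (q : ℤ) :
    LinearizedBundle.twist q ⋙ LinearizedBundle.pullback φ hφ hab ≅
      LinearizedBundle.pullback φ hφ hab ⋙ LinearizedBundle.twist q :=
  -- Twisting rescales the action and pull back reindexes it, so the two orders give definitionally
  -- equal linearized bundles.
  NatIso.ofComponents (fun E => Iso.refl (LinearizedBundle.twistObj q
    (LinearizedBundle.pullbackObj φ hφ hab E))) fun _ => rfl

/-! ### Tensoring with `𝒪(q)`, seen on the cone -/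

/-- Evaluation at `v` of the second factor, which is the fibre of `𝒪(q)` at the line through `v`. -/
def tensorSerreEval (q : ℤ) (v : PuncturedSpace n) (M : Type) [AddCommGroup M] [Module ℂ M] :
    M ⊗[ℂ] serreFiber q (eta v) →ₗ[ℂ] M :=
  TensorProduct.rid ℂ M ∘ₗ (serreEval q v).lTensor M

lemma tensorSerreEval_tmul (q : ℤ) (v : PuncturedSpace n) {M : Type} [AddCommGroup M] [Module ℂ M]
    (m : M) (φ : serreFiber q (eta v)) :
    tensorSerreEval q v M (m ⊗ₜ φ) = serreEval q v φ • m := by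
  simp [tensorSerreEval]

/-- The map `m ↦ m ⊗ serreUnit q v`, inverse to `tensorSerreEval`. -/
def tmulSerreUnit (q : ℤ) (v : PuncturedSpace n) (M : Type) [AddCommGroup M] [Module ℂ M] :
    M →ₗ[ℂ] M ⊗[ℂ] serreFiber q (eta v) :=
  (TensorProduct.mk ℂ M (serreFiber q (eta v))).flip (serreUnit q v)

lemma tensorSerreEval_tmulSerreUnit (q : ℤ) (v : PuncturedSpace n) {M : Type} [AddCommGroup M]
    [Module ℂ M] (m : M) : tensorSerreEval q v M (tmulSerreUnit q v M m) = m := by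
  refine (tensorSerreEval_tmul q v m _).trans ?_
  rw [serreEval_serreUnit, one_smul]

/-- On a pure tensor `m ⊗ φ`, the scalar `φ(v)` moves across the tensor sign and rebuilds `φ` from
the unit. -/
lemma tmulSerreUnit_tensorSerreEval (q : ℤ) (v : PuncturedSpace n) {M : Type} [AddCommGroup M]
    [Module ℂ M] (z : M ⊗[ℂ] serreFiber q (eta v)) :
    tmulSerreUnit q v M (tensorSerreEval q v M z) = z := by
  induction z using TensorProduct.induction_on with
  | zero => simp
  | add x y hx hy => rw [map_add, map_add, hx, hy]
  | tmul m φ =>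
    rw [tensorSerreEval_tmul]
    change (serreEval q v φ • m) ⊗ₜ[ℂ] serreUnit q v = _
    rw [TensorProduct.smul_tmul, serreEval_smul_serreUnit]

lemma cast_tmul {X : Type} {M N : X → Type} [∀ x, AddCommGroup (M x)] [∀ x, Module ℂ (M x)]
    [∀ x, AddCommGroup (N x)] [∀ x, Module ℂ (N x)] {x y : X} (p : x = y) (m : M x) (k : N x) :
    LinearEquiv.cast (R := ℂ) (M := fun x => M x ⊗[ℂ] N x) p (m ⊗ₜ k) =
      LinearEquiv.cast (R := ℂ) (M := M) p m ⊗ₜ LinearEquiv.cast (R := ℂ) (M := N) p k := by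
  subst p
  rfl

/-- The cast is the action on `η^* (F ⊗ 𝒪(q))`. The factor `t ^ q` by which it rescales the unit
passes to the first factor, where it becomes the twist of the action; this is the equivariance of `m
↦ m ⊗ serreUnit q v`. -/
lemma cast_tmulSerreUnit {F : ℙ ℂ (Fin (n + 1) → ℂ) → Type} [∀ x, AddCommGroup (F x)]
    [∀ x, Module ℂ (F x)] {q : ℤ} {t : ℂˣ} {v w : PuncturedSpace n}
    (h : (scalarAction n).smul t v = w) (p : eta v = eta w) (z : F (eta v)) :
    LinearEquiv.cast (R := ℂ) (M := fun x => F x ⊗[ℂ] serreFiber q x) p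
        (tmulSerreUnit q v (F (eta v)) z) =
      tmulSerreUnit q w (F (eta w)) ((t : ℂ) ^ q • LinearEquiv.cast (R := ℂ) (M := F) p z) := by
  refine (cast_tmul (N := fun x => serreFiber q x) p z (serreUnit q v)).trans ?_
  rw [cast_serreUnit h p, TensorProduct.tmul_smul, TensorProduct.smul_tmul']
  rfl

lemma pullbackRegAt_tmulSerreUnit {E : VectorBundle (ℙ ℂ (Fin (n + 1) → ℂ))} (q : ℤ)
    {s : ∀ v : PuncturedSpace n, E.Fiber (eta v)} {v : PuncturedSpace n}
    (hs : VectorBundle.PullbackRegAt eta E s v) :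
    VectorBundle.PullbackRegAt eta (E.tensorObj (serreTwist n q))
      (fun w => tmulSerreUnit q w (E.Fiber (eta w)) (s w)) v := by
  obtain ⟨κ, _, c, e, hc, he, hs⟩ := hs
  obtain ⟨ι, _, d, f, hd, hf, hu⟩ := pullbackRegAt_serreUnit q v
  -- Both `s` and the unit section are combinations of pulled back sections, so their tensor product
  -- is the double sum of the tensors of these, with the products of the coefficients.
  refine ⟨κ × ι, inferInstance, fun i w => c i.1 w * d i.2 w, fun i x => e i.1 x ⊗ₜ f i.2 x,
    fun i => regularAt_mul (hc _) (hd _), fun i => ⟨Unit, inferInstance, fun _ => e i.1,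
      fun _ => f i.2, fun _ => he _, fun _ => hf _, .of_forall fun z => by simp⟩, ?_⟩
  filter_upwards [hs, hu] with w h1 h2
  refine (congrArg₂ (fun (a : E.Fiber (eta w)) (b : (serreTwist n q).Fiber (eta w)) =>
    a ⊗ₜ[ℂ] b) h1 h2).trans ?_
  rw [TensorProduct.sum_tmul, Fintype.sum_prod_type]
  refine Finset.sum_congr rfl fun k _ => (TensorProduct.tmul_sum _ _ _).trans ?_
  exact Finset.sum_congr rfl fun i _ => TensorProduct.smul_tmul_smul _ _ _ _

/-- A regular section of `E ⊗ 𝒪(q)` is locally a sum of tensors `f ⊗ g`. Evaluation turns the pull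
back of each into `g(w) f`, where `w ↦ g(w)` is regular on the cone by the definition of regularity
for `𝒪(q)`. -/
lemma pullbackRegAt_tensorSerreEval {E : VectorBundle (ℙ ℂ (Fin (n + 1) → ℂ))} {q : ℤ}
    {s : ∀ v : PuncturedSpace n, E.Fiber (eta v) ⊗[ℂ] serreFiber q (eta v)} {v : PuncturedSpace n}
    (hs : VectorBundle.PullbackRegAt eta (E.tensorObj (serreTwist n q)) s v) :
    VectorBundle.PullbackRegAt eta E
      (fun w => tensorSerreEval q w (E.Fiber (eta w)) (s w)) v := by
  obtain ⟨κ, _, c, e, hc, he, hs⟩ := hs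
  choose ι hι f g hf hg h using he
  -- The decompositions into pure tensors hold near `eta v` on `ℙ(V)`; continuity of `η` makes them
  -- available at all points of the cone near `v`.
  have h' := fun k => (regularMap_eta v).1.eventually (h k)
  refine ⟨Σ k, ι k, inferInstance, fun i w => c i.1 w * serreEval q w (g i.1 i.2 (eta w)),
    fun i => f i.1 i.2, fun i => regularAt_mul (hc _) (hg i.1 i.2 v rfl), fun i => hf _ _, ?_⟩
  filter_upwards [hs, eventually_all.2 h'] with w h1 h2
  refine (congrArg (tensorSerreEval q w (E.Fiber (eta w))) h1).trans ?_
  refine (map_sum (tensorSerreEval q w (E.Fiber (eta w))) _ _).trans ?_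
  rw [Fintype.sum_sigma]
  refine Finset.sum_congr rfl fun k _ => ?_
  refine (map_smul (tensorSerreEval q w (E.Fiber (eta w))) _ _).trans ?_
  have h3 := (congrArg (tensorSerreEval q w (E.Fiber (eta w))) (h2 k)).trans
    (map_sum (tensorSerreEval q w (E.Fiber (eta w))) _ _)
  refine (congrArg (c k w • ·) h3).trans (Finset.smul_sum.trans ?_)
  refine Finset.sum_congr rfl fun i _ => Eq.trans ?_ (mul_smul _ _ _).symm
  exact congrArg (c k w • ·) (tensorSerreEval_tmul q w _ _)

/-- Under `η^*`, the tensor product with `𝒪(q)` corresponds to the multiplication of the action by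
the character `t ^ q`. -/
def etaPullbackTwistIsoObj (q : ℤ) (E : VectorBundle (ℙ ℂ (Fin (n + 1) → ℂ))) :
    LinearizedBundle.twistObj q ((etaPullback n).obj E) ≅
      (etaPullback n).obj (E.tensorObj (serreTwist n q)) where
  hom :=
    { hom :=
        { map := fun v => tmulSerreUnit q v (E.Fiber (eta v))
          regular := fun s v hs => pullbackRegAt_tmulSerreUnit q hs }
      equivariant := fun t v w h z =>
        (cast_tmulSerreUnit (F := E.Fiber) h (eta_eq_iff.2 ⟨t, h⟩) z).symm }
  inv :=
    { hom :=
        { map := fun v => tensorSerreEval q v (E.Fiber (eta v))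
          regular := fun s v hs => pullbackRegAt_tensorSerreEval hs }
      equivariant := fun t v w h z => by
        have p : eta v = eta w := eta_eq_iff.2 ⟨t, h⟩
        -- Equivariance of the inverse follows from that of the direct map: write `z` as the image
        -- of its evaluation, apply the direct statement, then evaluate at `w`.
        have h1 := cast_tmulSerreUnit (F := E.Fiber) (q := q) h p (tensorSerreEval q v (E.Fiber (eta v)) z)
        have h2 := (congrArg (LinearEquiv.cast (R := ℂ)
          (M := fun x => E.Fiber x ⊗[ℂ] serreFiber q x) p)
            (tmulSerreUnit_tensorSerreEval q v z)).symm.trans h1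
        exact (congrArg (tensorSerreEval q w (E.Fiber (eta w))) h2).trans
          (tensorSerreEval_tmulSerreUnit q w _) }
  hom_inv_id := LinearizedBundle.hom_ext (VectorBundle.hom_ext fun v z =>
    tensorSerreEval_tmulSerreUnit q v z)
  inv_hom_id := LinearizedBundle.hom_ext (VectorBundle.hom_ext fun v z =>
    tmulSerreUnit_tensorSerreEval q v z)

/-- `η^*` takes the tensor product with `𝒪(q)` to the multiplication of the action by `t ^ q`. -/
def etaPullbackTwistIso (n : ℕ) (q : ℤ) : etaPullback n ⋙ LinearizedBundle.twist q ≅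
    VectorBundle.tensorRight (serreTwist n q) ⋙ etaPullback n :=
  -- Naturality holds because both composites send `m` to `f(m) ⊗ serreUnit q v`.
  NatIso.ofComponents (etaPullbackTwistIsoObj q) fun _ =>
    LinearizedBundle.hom_ext (VectorBundle.hom_ext fun _ _ => rfl)

/-! ### The isomorphisms for the generalized inverse image -/

section Iminvg

variable {d : Fin (n + 1) → ℕ} (g : Fin (n + 1) → MvPolynomial (Fin (n + 1)) ℂ)
  (hd : ∀ i, (g i).IsHomogeneous (d i))
  (hg : ∀ v : Fin (n + 1) → ℂ, v ≠ 0 → ∃ i, MvPolynomial.eval v (g i) ≠ 0)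

/-- Multiplication of the action by a character commutes with `ω^* η_2^*`. -/
def twistCompOmegaEtaPullback (q : ℤ) :
    LinearizedBundle.twist q ⋙ omegaEtaPullback g hd hg ≅
      omegaEtaPullback g hd hg ⋙ LinearizedBundle.twist q :=
  Functor.isoWhiskerRight (LinearizedBundle.twistCompPullback eta regularMap_eta
      (eta_weightAction d) q)
    (LinearizedBundle.pullback (omega g hg) (regularMap_omega g hg) (omega_smul g hd hg)) ≪≫
  Functor.isoWhiskerLeft (LinearizedBundle.pullback eta regularMap_eta (eta_weightAction d))
    (LinearizedBundle.twistCompPullback (omega g hg) (regularMap_omega g hg)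
      (omega_smul g hd hg) q)

/-- `Iminvg (E^{(q)}) ≅ Iminvg E ⊗ 𝒪(q)`, naturally in `E`. -/
def twistCompIminvg (q : ℤ) : LinearizedBundle.twist q ⋙ Iminvg g hd hg ≅
    Iminvg g hd hg ⋙ VectorBundle.tensorRight (serreTwist n q) :=
  -- After `η_1^*`, both functors become `E ↦ (ω^* η_2^* E)^{(q)}`. Reassociations of composite
  -- functors hold definitionally and are left implicit.
  Functor.fullyFaithfulCancelRight (etaPullback n)
    (Functor.isoWhiskerLeft (LinearizedBundle.twist q) (iminvgCompEtaPullback g hd hg) ≪≫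
      twistCompOmegaEtaPullback g hd hg q ≪≫
      Functor.isoWhiskerRight (iminvgCompEtaPullback g hd hg).symm (LinearizedBundle.twist q) ≪≫
      Functor.isoWhiskerLeft (Iminvg g hd hg) (etaPullbackTwistIso n q))

/-- The action on `ω^* η^* 𝒪(k)` induced by `σ` preserves the values. -/
lemma serreEval_act (k : ℤ) {t : ℂˣ} {v w : PuncturedSpace n} (h : (weightAction d).smul t v = w)
    (h' : (projWeightAction d).smul t (eta v) = eta w) (φ : serreFiber k (eta v)) :
    serreEval k w ((linearizedSerreTwist d k).act t h' φ) = serreEval k v φ := by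
  -- The value at `w` of the transported function is, by definition, that of `φ` at `σ(t)⁻¹ w`, a
  -- point equal to `v` but not definitionally.
  have key : ∀ u (hu : eta u = eta v), u = v → φ.1 ⟨u, hu⟩ = φ.1 ⟨v, rfl⟩ := by
    rintro u hu rfl
    rfl
  exact key _ _ ((AlgAction.smul_eq_iff _).1 h).symm

/-- Values are preserved, so the unit section is invariant under the action induced by `σ`. Hence
`k` leaves no trace in the generalized inverse image. -/
lemma act_serreUnit (k : ℤ) {t : ℂˣ} {v w : PuncturedSpace n} (h : (weightAction d).smul t v = w)
    (h' : (projWeightAction d).smul t (eta v) = eta w) :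
    (linearizedSerreTwist d k).act t h' (serreUnit k v) = serreUnit k w := by
  refine serreFiber_ext ?_
  exact (serreEval_act k h h' (serreUnit k v)).trans
    ((serreEval_serreUnit k v).trans (serreEval_serreUnit k w).symm)

/-- The points `v`, `w` and the degrees are independent, so that this one identity settles both
composites below, with `v` and `ω(v)` exchanging roles. -/
lemma serreEval_smul_serreUnit_smul_serreUnit {m : ℕ} {k q : ℤ} {v : PuncturedSpace n}
    (w : PuncturedSpace m) (φ : serreFiber q (eta v)) :
    serreEval k w (serreEval q v φ • serreUnit k w) • serreUnit q v = φ := by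
  rw [map_smul, serreEval_serreUnit, smul_eq_mul, mul_one, serreEval_smul_serreUnit]

/-- Both `ω^* η^* 𝒪^{(q)}(k)` and `η^* 𝒪(q)` are the trivial line bundle on which `t` acts by
`t ^ q`. -/
def omegaEtaPullbackSerreIso (q k : ℤ) :
    (omegaEtaPullback g hd hg).obj ((LinearizedBundle.twist q).obj (linearizedSerreTwist d k)) ≅
      (etaPullback n).obj (serreTwist n q) where
  hom :=
    { hom :=
        -- The map sends the unit of degree `k` at `ω(v)` to the unit of degree `q` at `v`.
        { map := fun v => (serreEval k (omega g hg v)).smulRight (serreUnit q v)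
          regular := fun s v hs =>
            VectorBundle.regAt_smul (E := ((etaPullback n).obj (serreTwist n q)).toVectorBundle)
              (regularAt_serreEval_comp (regularMap_omega g hg) hs)
              (pullbackRegAt_serreUnit q v) }
      equivariant := fun t v w h φ => by
        have p : eta v = eta w := eta_eq_iff.2 ⟨t, h⟩
        have h1 : (weightAction d).smul t (omega g hg v) = omega g hg w := by
          rw [← omega_smul g hd hg, h]
        have h2 := (eta_weightAction d t (omega g hg v)).symm.trans (congrArg eta h1)
        -- On the source, `t ^ q` comes only from the twist. It is put on the right of the product
        -- so that it ends next to `serreUnit q w`, where `cast_serreUnit` absorbs it.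
        have h3 : serreEval k (omega g hg w)
            ((t : ℂ) ^ q • (linearizedSerreTwist d k).act t h2 φ) =
              serreEval k (omega g hg v) φ * (t : ℂ) ^ q := by
          rw [mul_comm]
          exact (map_smul (serreEval k (omega g hg w)) _ _).trans
            (congrArg _ (serreEval_act k h1 h2 φ))
        refine (congrArg (· • serreUnit q w) h3).trans ((mul_smul _ _ _).trans ?_)
        refine (congrArg _ (cast_serreUnit h p).symm).trans ?_
        exact (map_smul (LinearEquiv.cast (R := ℂ) (M := fun x => serreFiber q x) p) _ _).symm }
  inv :=
    { hom :=
        { map := fun v => (serreEval q v).smulRight (serreUnit k (omega g hg v))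
          regular := fun s v hs =>
            VectorBundle.regAt_smul (E := ((omegaEtaPullback g hd hg).obj
                ((LinearizedBundle.twist q).obj (linearizedSerreTwist d k))).toVectorBundle)
              (regularAt_serreEval hs)
              -- The units at the points `ω(v)` form the pull back along `ω` of the unit section of
              -- `η_2^* 𝒪(k)`.
              (VectorBundle.pullbackRegAt_comp (omega g hg)
                (E := (serreTwist n k).pullbackObj eta regularMap_eta)
                (pullbackRegAt_serreUnit k (omega g hg v))) }
      equivariant := fun t v w h φ => by
        have p : eta v = eta w := eta_eq_iff.2 ⟨t, h⟩
        have h1 : (weightAction d).smul t (omega g hg v) = omega g hg w := by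
          rw [← omega_smul g hd hg, h]
        have h2 := (eta_weightAction d t (omega g hg v)).symm.trans (congrArg eta h1)
        -- In this direction `t ^ q` arises from the homogeneity of `φ` and is matched with the
        -- twist, the unit at `ω(v)` being carried to the unit at `ω(w)`.
        refine (congrArg (· • serreUnit k (omega g hg w)) (serreEval_cast h p φ)).trans ?_
        refine (mul_smul _ _ _).trans (congrArg ((t : ℂ) ^ q • ·) ?_)
        refine (congrArg _ (act_serreUnit k h1 h2).symm).trans ?_
        exact (map_smul ((linearizedSerreTwist d k).act t h2) _ _).symm }
  hom_inv_id := LinearizedBundle.hom_ext (VectorBundle.hom_ext fun v z =>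
    serreEval_smul_serreUnit_smul_serreUnit v z)
  inv_hom_id := LinearizedBundle.hom_ext (VectorBundle.hom_ext fun v z =>
    serreEval_smul_serreUnit_smul_serreUnit (omega g hg v) z)

/-- `Iminvg (𝒪^{(q)}(k)) ≅ 𝒪(q)`. -/
def iminvgSerreIso (q k : ℤ) :
    (Iminvg g hd hg).obj ((LinearizedBundle.twist q).obj (linearizedSerreTwist d k)) ≅
      serreTwist n q :=
  (etaPullback n).preimageIso ((iminvgCompEtaPullback g hd hg).app _ ≪≫
    omegaEtaPullbackSerreIso g hd hg q k)

end Iminvg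

end

end Horrocks

theorem proposition2p3 (n : ℕ) (d : Fin (n + 1) → ℕ)
    (g : Fin (n + 1) → MvPolynomial (Fin (n + 1)) ℂ)
    (hd : ∀ i, (g i).IsHomogeneous (d i))
    (hg : ∀ v : Fin (n + 1) → ℂ, v ≠ 0 → ∃ i, MvPolynomial.eval v (g i) ≠ 0)
    (q : ℤ) :
    (∀ k : ℤ, Nonempty ((Horrocks.Iminvg g hd hg).obj
        ((Horrocks.LinearizedBundle.twist q).obj (Horrocks.linearizedSerreTwist d k)) ≅
      Horrocks.serreTwist n q)) ∧
    Nonempty (Horrocks.LinearizedBundle.twist q ⋙ Horrocks.Iminvg g hd hg ≅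
      Horrocks.Iminvg g hd hg ⋙
        Horrocks.VectorBundle.tensorRight (Horrocks.serreTwist n q)) :=
  ⟨fun k => ⟨Horrocks.iminvgSerreIso g hd hg q k⟩, ⟨Horrocks.twistCompIminvg g hd hg q⟩⟩
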